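/- Let $n\ge 5$, $p=\frac{n+2}{n-2}$, and let $Q(y)=\left(1+\frac{|y|^2}{n(n-2)}\right)^{-\frac{n-2}{2}}$, $y\in\mathbb{R}^n$, be the Talenti function. For $R>0$ let $B_R=\{y\in\mathbb{R}^n:|y|<R\}$ and consider the radial Dirichlet eigenvalue problem $$-(\Delta+pQ^{p-1})\psi=\mu\psi\ \text{ in } B_R,\qquad \psi=0\ \text{ on }\partial B_R,\qquad \psi\ \text{radially symmetric},$$ with classical eigenfunctions $\psi\in C^2(B_R)\cap C(\overline{B_R})$. Let $\mu_1^{(R)}\le\mu_2^{(R)}\le\mu_3^{(R)}\le\cdots$ be its eigenvalues in increasing order, counted with multiplicity. Then there exists a constant $c>0$, depending only on $n$, such that for every $R>1$ the third eigenvalue $\mu_3^{(R)}$ exists and satisfies $$\mu_3^{(R)}>c\,R^{-\frac n2}.$$ -/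

import Mathlib

open scoped ContDiff

noncomputable section

namespace RadialDirichlet

/-- The critical Sobolev exponent `p = (n + 2) / (n - 2)`. -/
def critExp (n : ℕ) : ℝ := ((n : ℝ) + 2) / ((n : ℝ) - 2)

/-- The Talenti function `Q(y) = (1 + |y|² / (n (n - 2))) ^ (-(n - 2) / 2)` on `ℝⁿ`. -/
def talenti (n : ℕ) (y : EuclideanSpace ℝ (Fin n)) : ℝ :=
  (1 + 1 / ((n : ℝ) * ((n : ℝ) - 2)) * ‖y‖ ^ 2) ^ (-((n : ℝ) - 2) / 2)

/-- The potential `V = p Q ^ (p - 1)` of the linearized operator `H = Δ + V`. -/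
def potential (n : ℕ) (y : EuclideanSpace ℝ (Fin n)) : ℝ :=
  critExp n * talenti n y ^ (critExp n - 1)

/-- The space of classical solutions of the radial Dirichlet problem
`-(Δ + V) ψ = μ ψ` in `B_R`, `ψ = 0` on `∂B_R`, `ψ` radially symmetric, with
`ψ ∈ C²(B_R) ∩ C(closure B_R)`. In order that a function on the closed ball is represented
exactly once, it is extended by zero outside the ball; continuity of the extension
is continuity on the closed ball together with the Dirichlet condition. -/
def eigenspace (n : ℕ) (R μ : ℝ) : Submodule ℝ (EuclideanSpace ℝ (Fin n) → ℝ) where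
  carrier := {ψ |
    Continuous ψ ∧
    ContDiffOn ℝ 2 ψ (Metric.ball 0 R) ∧
    (∀ x y, ‖x‖ = ‖y‖ → ψ x = ψ y) ∧
    (∀ x, R ≤ ‖x‖ → ψ x = 0) ∧
    ∀ x ∈ Metric.ball (0 : EuclideanSpace ℝ (Fin n)) R,
      -(Laplacian.laplacian ψ x + potential n x * ψ x) = μ * ψ x}
  zero_mem' := by
    refine ⟨continuous_const, contDiffOn_const, fun _ _ _ => rfl, fun _ _ => rfl, ?_⟩
    intro x _
    have h : Laplacian.laplacian (0 : EuclideanSpace ℝ (Fin n) → ℝ) x = 0 := by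
      have := InnerProductSpace.laplacian_smul (0 : ℝ)
        (contDiff_const (c := (0 : ℝ)) : ContDiff ℝ 2 (fun _ : EuclideanSpace ℝ (Fin n) =>
          (0 : ℝ))).contDiffAt (x := x)
      simpa using this
    simp [h]
  add_mem' := by
    rintro f g ⟨f1, f2, f3, f4, f5⟩ ⟨g1, g2, g3, g4, g5⟩
    refine ⟨f1.add g1, f2.add g2, fun x y h => ?_, fun x h => ?_, fun x hx => ?_⟩
    · simp [f3 x y h, g3 x y h]
    · simp [f4 x h, g4 x h]
    · have hU := Metric.isOpen_ball.mem_nhds hx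
      rw [(f2.contDiffAt hU).laplacian_add (g2.contDiffAt hU)]
      have h1 := f5 x hx
      have h2 := g5 x hx
      simp only [Pi.add_apply]
      linarith
  smul_mem' := by
    rintro a f ⟨f1, f2, f3, f4, f5⟩
    refine ⟨f1.const_smul a, f2.const_smul a, fun x y h => ?_, fun x h => ?_, fun x hx => ?_⟩
    · simp [f3 x y h]
    · simp [f4 x h]
    · have hU := Metric.isOpen_ball.mem_nhds hx
      rw [InnerProductSpace.laplacian_smul a (f2.contDiffAt hU)]
      have h1 := f5 x hx
      simp only [Pi.smul_apply, smul_eq_mul]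
      linear_combination a * h1

/-- `μ` is the `i`-th eigenvalue (`i = 1, 2, 3, …`) of the radial Dirichlet problem on `B_R`, in
increasing order and counted with multiplicity: the eigenvalues below `μ` have total
multiplicity less than `i`, and the eigenvalues up to and including `μ` have total multiplicity
at least `i`. For `i ≥ 1` there is at most one such `μ`, and it is an eigenvalue. -/
def IsNthEigenvalue (n : ℕ) (R : ℝ) (i : ℕ) (μ : ℝ) : Prop :=
  Module.rank ℝ (⨆ ν : Set.Iio μ, eigenspace n R ν : Submodule ℝ _) < i ∧
  (i : Cardinal) ≤ Module.rank ℝ (⨆ ν : Set.Iic μ, eigenspace n R ν : Submodule ℝ _)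

end RadialDirichlet

end

/-! Lower bound. By a min-max count, it suffices that every radial function vanishing at two fixed
radii has quadratic form above the level `c * R ^ (-n / 2)`. Picone's inequality gives this on each
of the three resulting intervals once a positive supersolution (`HasBarrier`) is known there. In the
variable x = |y|² / (n(n-2)) the scaling generator Z = (1-x)(1+x)^(-n/2) lies in the kernel of Δ + V
and changes sign only at x = 1. The barriers are: Z minus a small constant inside; -KZ + (2 - xⁿ) on
an annulus around x = 1; and the Hardy power r^(-(n-2)/2) outside, where V is dominated by the Hardy
term. The first two give levels independent of R, the last a multiple of R⁻². Since n/2 ≥ 2 and R >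
1, R⁻² dominates R^(-n/2). Evaluation at the two radii is therefore injective on the span of the
eigenfunctions with eigenvalue at most `c * R ^ (-n / 2)`, so that span has dimension at most two
(`rank_spectralSpace_le`, `exists_rank_spectralSpace_le_two`).

Existence. The regular solution with value 1 at the origin solves a Volterra equation and depends
continuously on μ = s². Its Prüfer angle at R is continuous in s and tends to -∞, so it takes
infinitely many values at which the solution vanishes at R (`exists_vanishing`,
`exists_eigenvalues`). Using many short intervals, the same barrier count shows that only finitely
many eigenvalues lie below any level, so they can be listed in increasing order
(`exists_isNthEigenvalue`). -/

noncomputable section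

namespace RadialDirichlet

open Filter Topology Set intervalIntegral

/-! ### Radial form of the Laplacian and of the potential -/

/-- The Laplacian of `y ↦ F (‖y‖²)`. -/
lemma laplacian_comp_normSq {n : ℕ} {F F1 : ℝ → ℝ} {F2 : ℝ} (x : EuclideanSpace ℝ (Fin n))
    (hF : ∀ᶠ t in 𝓝 (‖x‖ ^ 2), HasDerivAt F (F1 t) t) (hF1 : HasDerivAt F1 F2 (‖x‖ ^ 2)) :
    Laplacian.laplacian (fun y : EuclideanSpace ℝ (Fin n) => F (‖y‖ ^ 2)) x
      = 4 * ‖x‖ ^ 2 * F2 + 2 * n * F1 (‖x‖ ^ 2) := by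
  -- An ℝ-linear copy of `innerSL`, so that y ↦ B y has derivative B.
  obtain ⟨B, hB⟩ : ∃ B : EuclideanSpace ℝ (Fin n) →L[ℝ] EuclideanSpace ℝ (Fin n) →L[ℝ] ℝ,
      ∀ y, B y = innerSL ℝ y :=
    ⟨LinearMap.mkContinuous₂ (innerₗ _) 1 fun x y => by simpa using abs_real_inner_le_norm x y,
      fun y => by ext v; simp⟩
  have hns : ∀ y : EuclideanSpace ℝ (Fin n),
      HasFDerivAt (fun y : EuclideanSpace ℝ (Fin n) => ‖y‖ ^ 2) (2 • B y) y := fun y => by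
    rw [hB]; exact (hasStrictFDerivAt_norm_sq y).hasFDerivAt
  have hcont : Tendsto (fun y : EuclideanSpace ℝ (Fin n) => ‖y‖ ^ 2) (𝓝 x) (𝓝 (‖x‖ ^ 2)) :=
    (hns x).continuousAt
  have h1 : fderiv ℝ (fun y : EuclideanSpace ℝ (Fin n) => F (‖y‖ ^ 2)) =ᶠ[𝓝 x]
      fun y => (2 * F1 (‖y‖ ^ 2)) • B y := by
    filter_upwards [hcont.eventually hF] with y hy
    have h := (hy.comp_hasFDerivAt y (hns y)).fderiv
    have h' : fderiv ℝ (fun y : EuclideanSpace ℝ (Fin n) => F (‖y‖ ^ 2)) y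
      = F1 (‖y‖ ^ 2) • 2 • B y := h
    rw [h']
    ext v
    simp
    ring
  have h2 : HasFDerivAt (fun y : EuclideanSpace ℝ (Fin n) => (2 * F1 (‖y‖ ^ 2)) • B y)
      ((2 * F1 (‖x‖ ^ 2)) • B +
        ((2 : ℝ) • F2 • (2 • B x)).smulRight (B x)) x := by
    have ha := (hF1.comp_hasFDerivAt x (hns x)).const_mul 2
    exact ha.smul B.hasFDerivAt
  have h3 : fderiv ℝ (fderiv ℝ (fun y : EuclideanSpace ℝ (Fin n) => F (‖y‖ ^ 2))) x = _ :=
    (h1.fderiv_eq).trans h2.fderiv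
  have h4 : ‖x‖ ^ 2 = ∑ i, x i * x i := by
    rw [EuclideanSpace.norm_sq_eq]
    exact Finset.sum_congr rfl fun i _ => by rw [Real.norm_eq_abs, sq_abs, sq]
  rw [InnerProductSpace.laplacian_eq_iteratedFDeriv_orthonormalBasis _
    (EuclideanSpace.basisFun (Fin n) ℝ)]
  simp only [iteratedFDeriv_two_apply, h3]
  simp only [add_apply, ContinuousLinearMap.smulRight_apply, smul_apply, hB]
  have h5 : ∀ i : Fin n, inner ℝ x (EuclideanSpace.single i (1 : ℝ)) = x i := fun i => by
    simp [EuclideanSpace.inner_single_right]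
  simp [h5, Finset.sum_add_distrib]
  rw [h4, Finset.mul_sum, Finset.sum_mul]
  rw [add_comm]
  congr 1
  · exact Finset.sum_congr rfl fun i _ => by ring
  · ring

/-- The potential as a rational function of the radius. -/
lemma potential_eq {n : ℕ} (hn : 5 ≤ n) (y : EuclideanSpace ℝ (Fin n)) :
    potential n y = critExp n / (1 + 1 / ((n : ℝ) * ((n : ℝ) - 2)) * ‖y‖ ^ 2) ^ 2 := by
  have hn' : (5 : ℝ) ≤ n := by exact_mod_cast hn
  have h2 : (n : ℝ) - 2 ≠ 0 := by linarith
  have hb : 0 ≤ 1 + 1 / ((n : ℝ) * ((n : ℝ) - 2)) * ‖y‖ ^ 2 := by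
    have : 0 < (n : ℝ) * ((n : ℝ) - 2) := mul_pos (by linarith) (by linarith)
    positivity
  unfold potential talenti
  rw [← Real.rpow_mul hb]
  have : -((n : ℝ) - 2) / 2 * (critExp n - 1) = -((2 : ℕ) : ℝ) := by
    unfold critExp
    field_simp
    push_cast
    ring
  rw [this, Real.rpow_neg hb, Real.rpow_natCast, ← div_eq_mul_inv]

/-- The potential `V` as a function of the radius. -/
def radialPotential (n : ℕ) (r : ℝ) : ℝ :=
  critExp n / (1 + 1 / ((n : ℝ) * ((n : ℝ) - 2)) * r ^ 2) ^ 2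

lemma potential_eq_radialPotential {n : ℕ} (hn : 5 ≤ n) (y : EuclideanSpace ℝ (Fin n)) :
    potential n y = radialPotential n ‖y‖ := potential_eq hn y

lemma mul_sub_two_pos {n : ℕ} (hn : 5 ≤ n) : 0 < (n : ℝ) * ((n : ℝ) - 2) := by
  have hn' : (5 : ℝ) ≤ n := by exact_mod_cast hn
  exact mul_pos (by linarith) (by linarith)

lemma critExp_pos {n : ℕ} (hn : 5 ≤ n) : 0 < critExp n := by
  have hn' : (5 : ℝ) ≤ n := by exact_mod_cast hn
  exact div_pos (by linarith) (by linarith)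

lemma one_le_radialPotential_denom {n : ℕ} (hn : 5 ≤ n) (r : ℝ) :
    1 ≤ 1 + 1 / ((n : ℝ) * ((n : ℝ) - 2)) * r ^ 2 := by
  have := mul_sub_two_pos hn
  have : 0 ≤ 1 / ((n : ℝ) * ((n : ℝ) - 2)) * r ^ 2 := by positivity
  linarith

lemma continuous_radialPotential {n : ℕ} (hn : 5 ≤ n) : Continuous (radialPotential n) := by
  unfold radialPotential
  refine Continuous.div (by fun_prop) (by fun_prop) fun r => ?_
  have := one_le_radialPotential_denom hn r
  positivity

lemma radialPotential_pos {n : ℕ} (hn : 5 ≤ n) (r : ℝ) : 0 < radialPotential n r := by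
  have := one_le_radialPotential_denom hn r
  have := critExp_pos hn
  unfold radialPotential
  positivity

lemma radialPotential_le {n : ℕ} (hn : 5 ≤ n) (r : ℝ) : radialPotential n r ≤ critExp n := by
  have := one_le_radialPotential_denom hn r
  have := critExp_pos hn
  unfold radialPotential
  exact div_le_self this.le (one_le_pow₀ (by assumption))

/-! ### Radial profiles, Green's identity and Picone's inequality -/

/-- The flux `∫₀ʳ x ^ (n - 1) h(x) dx` of the radial Laplacian `h`. -/
def flux (n : ℕ) (h : ℝ → ℝ) (r : ℝ) : ℝ := ∫ x in (0 : ℝ)..r, x ^ (n - 1) * h x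

lemma hasDerivAt_flux {n : ℕ} {h : ℝ → ℝ} (hh : Continuous h) (r : ℝ) :
    HasDerivAt (flux n h) (r ^ (n - 1) * h r) r :=
  ((continuous_id.pow (n - 1)).mul hh).integral_hasStrictDerivAt 0 r |>.hasDerivAt

lemma continuous_flux {n : ℕ} {h : ℝ → ℝ} (hh : Continuous h) : Continuous (flux n h) :=
  continuous_iff_continuousAt.2 fun r => (hasDerivAt_flux hh r).continuousAt

@[simp] lemma flux_zero (n : ℕ) (h : ℝ → ℝ) : flux n h 0 = 0 := by simp [flux]

/-- `f` is a radial profile on the ball of radius `R`, vanishing outside, with radial Laplacian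
`h`. -/
structure RadialPair (n : ℕ) (R : ℝ) (f h : ℝ → ℝ) : Prop where
  cont : Continuous f
  cont_lap : Continuous h
  eq_zero : ∀ r, R ≤ r → f r = 0
  hasDerivAt : ∀ r ∈ Ioo 0 R, HasDerivAt f (flux n h r / r ^ (n - 1)) r

lemma RadialPair.sum {n : ℕ} {R : ℝ} {ι : Type*} (s : Finset ι) {f h : ι → ℝ → ℝ}
    (H : ∀ i ∈ s, RadialPair n R (f i) (h i)) :
    RadialPair n R (fun r => ∑ i ∈ s, f i r) (fun r => ∑ i ∈ s, h i r) where
  cont := continuous_finsetSum _ fun i hi => (H i hi).cont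
  cont_lap := continuous_finsetSum _ fun i hi => (H i hi).cont_lap
  eq_zero r hr := Finset.sum_eq_zero fun i hi => (H i hi).eq_zero r hr
  hasDerivAt r hr := by
    have h1 : flux n (fun r => ∑ i ∈ s, h i r) r = ∑ i ∈ s, flux n (h i) r := by
      unfold flux
      simp only [Finset.mul_sum]
      refine intervalIntegral.integral_finsetSum fun i hi => ?_
      exact ((continuous_id.pow (n - 1)).mul (H i hi).cont_lap).intervalIntegrable _ _
    rw [h1, Finset.sum_div]
    exact HasDerivAt.fun_sum fun i hi => (H i hi).hasDerivAt r hr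

/-- Green's identity for two radial profiles. -/
lemma RadialPair.green {n : ℕ} {R : ℝ} (hR : 0 < R) {f h g k : ℝ → ℝ} (hf : RadialPair n R f h)
    (hg : RadialPair n R g k) :
    ∫ x in (0 : ℝ)..R, x ^ (n - 1) * (h x * g x - f x * k x) = 0 := by
  have := hf.cont; have := hf.cont_lap; have := hg.cont; have := hg.cont_lap
  have h1 := continuous_flux (n := n) hf.cont_lap
  have h2 := continuous_flux (n := n) hg.cont_lap
  -- The flux replaces r^(n-1) f'. It is continuous up to both endpoints and zero at 0, so f' is
  -- needed only in the open interval.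
  have h3 := integral_eq_sub_of_hasDerivAt_of_le (f := fun x => flux n h x * g x - f x * flux n k x)
    (f' := fun x => x ^ (n - 1) * (h x * g x - f x * k x)) hR.le (by fun_prop) (fun x hx => by
      have := (((hasDerivAt_flux (n := n) hf.cont_lap x).mul (hg.hasDerivAt x hx)).sub
        ((hf.hasDerivAt x hx).mul (hasDerivAt_flux (n := n) hg.cont_lap x)))
      refine this.congr_deriv ?_
      ring) ((by fun_prop : Continuous _).intervalIntegrable _ _)
  rw [h3]
  simp [hf.eq_zero R le_rfl, hg.eq_zero R le_rfl]

/-- There is a positive strict supersolution: `w > 0` on `[α, β]` with `-(Δ + V) w ≥ l w` in the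
interior. -/
def HasBarrier (n : ℕ) (V : ℝ → ℝ) (l α β : ℝ) : Prop :=
  ∃ w W k : ℝ → ℝ, ContinuousOn w (Icc α β) ∧ ContinuousOn W (Icc α β) ∧
    (∀ r ∈ Icc α β, 0 < w r) ∧ (α = 0 → W 0 = 0) ∧
    (∀ r ∈ Ioo α β, HasDerivAt w (W r / r ^ (n - 1)) r) ∧
    (∀ r ∈ Ioo α β, HasDerivAt W (r ^ (n - 1) * k r) r) ∧
    ∀ r ∈ Ioo α β, l * w r ≤ -(k r + V r * w r)

lemma HasBarrier.mono {n : ℕ} {V : ℝ → ℝ} {l α β l' β' : ℝ} (h : HasBarrier n V l α β)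
    (hl : l' ≤ l) (hβ : β' ≤ β) : HasBarrier n V l' α β' := by
  obtain ⟨w, W, k, h1, h2, h3, h4, h5, h6, h7⟩ := h
  have hs : Icc α β' ⊆ Icc α β := Icc_subset_Icc_right hβ
  have hs' : Ioo α β' ⊆ Ioo α β := Ioo_subset_Ioo_right hβ
  refine ⟨w, W, k, h1.mono hs, h2.mono hs, fun r hr => h3 r (hs hr), h4, fun r hr => h5 r (hs' hr),
    fun r hr => h6 r (hs' hr), fun r hr => le_trans ?_ (h7 r (hs' hr))⟩
  exact mul_le_mul_of_nonneg_right hl (h3 r (hs (Ioo_subset_Icc_self hr))).le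

/-- Picone's inequality. -/
lemma RadialPair.picone {n : ℕ} {R : ℝ} {f h V : ℝ → ℝ} {l α β : ℝ} (hf : RadialPair n R f h)
    (hV : Continuous V) (hα : 0 ≤ α) (hαβ : α ≤ β) (hβ : β ≤ R) (fα : α = 0 ∨ f α = 0)
    (fβ : f β = 0) (hw : HasBarrier n V l α β) :
    l * ∫ x in α..β, x ^ (n - 1) * f x ^ 2 ≤
      ∫ x in α..β, x ^ (n - 1) * (f x * -(h x + V x * f x)) := by
  obtain ⟨w, W, k, h1, h2, h3, h4, h5, h6, h7⟩ := hw
  have cf := hf.cont; have ch := hf.cont_lap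
  have cG := continuous_flux (n := n) hf.cont_lap
  have ci : Continuous fun x => x ^ (n - 1) * (f x * (h x + V x * f x) + l * f x ^ 2) := by
    fun_prop
  set Φ : ℝ → ℝ := fun r => (f r * flux n h r - f r ^ 2 * (W r / w r)) -
    ∫ x in α..r, x ^ (n - 1) * (f x * (h x + V x * f x) + l * f x ^ 2) with hΦ
  have hΦc : ContinuousOn Φ (Icc α β) := by
    refine ContinuousOn.sub (ContinuousOn.sub (by fun_prop)
      ((by fun_prop : ContinuousOn (fun r => f r ^ 2) _).mul
        (h2.div h1 fun x hx => (h3 x hx).ne'))) ?_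
    exact (continuous_primitive (fun a b => ci.intervalIntegrable a b) α).continuousOn
  have hmono : MonotoneOn Φ (Icc α β) := by
    refine monotoneOn_of_hasDerivWithinAt_nonneg (convex_Icc α β) hΦc
      -- The derivative of Φ is r^(n-1) times (f' - f w'/w)² + (f²/w)(-(Δ+V)w - l w). Both summands
      -- are nonnegative.
      (f' := fun r => r ^ (n - 1) * (flux n h r / r ^ (n - 1) -
        f r * (W r / r ^ (n - 1)) / w r) ^ 2 + r ^ (n - 1) * (f r ^ 2 / w r) *
          (-(k r + V r * w r) - l * w r)) ?_ ?_
    · intro r hr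
      rw [interior_Icc] at hr
      have hrR : r ∈ Ioo 0 R := ⟨hα.trans_lt hr.1, hr.2.trans_le hβ⟩
      have hwr := (h3 r (Ioo_subset_Icc_self hr)).ne'
      have hr0 : r ^ (n - 1) ≠ 0 := (pow_pos hrR.1 _).ne'
      have d1 := hf.hasDerivAt r hrR
      have d := ((d1.mul (hasDerivAt_flux (n := n) hf.cont_lap r)).sub
        ((d1.pow 2).mul ((h6 r hr).div (h5 r hr) hwr))).sub
        (ci.integral_hasStrictDerivAt α r).hasDerivAt
      refine (d.congr_deriv ?_).hasDerivWithinAt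
      simp only [Pi.pow_apply, Pi.div_apply]
      field_simp
      push_cast
      ring
    · intro r hr
      rw [interior_Icc] at hr
      have hwr := (h3 r (Ioo_subset_Icc_self hr))
      have hr0 : 0 < r ^ (n - 1) := pow_pos (hα.trans_lt hr.1) _
      have := h7 r hr
      have h8 : 0 ≤ -(k r + V r * w r) - l * w r := by linarith
      positivity
  have hle := hmono (left_mem_Icc.2 hαβ) (right_mem_Icc.2 hαβ) hαβ
  -- Where f need not vanish, at α = 0, both the flux and W do.
  have e1 : Φ α = 0 := by
    rcases fα with rfl | h0
    · simp [hΦ, h4 rfl]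
    · simp [hΦ, h0]
  have e2 : Φ β = -∫ x in α..β, x ^ (n - 1) * (f x * (h x + V x * f x) + l * f x ^ 2) := by
    simp [hΦ, fβ]
  rw [e1, e2, ← intervalIntegral.integral_neg] at hle
  rw [← intervalIntegral.integral_const_mul, ← sub_nonneg, ← intervalIntegral.integral_sub
    ((by fun_prop : Continuous _).intervalIntegrable _ _)
    ((by fun_prop : Continuous _).intervalIntegrable _ _)]
  refine hle.trans_eq (intervalIntegral.integral_congr fun x _ => ?_)
  ring

/-! ### Eigenfunctions as radial profiles; orthogonality -/

/-- The unit vector along which radial functions are sampled. -/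
def axis (n : ℕ) (hn : 5 ≤ n) : EuclideanSpace ℝ (Fin n) :=
  EuclideanSpace.single ⟨0, by omega⟩ 1

lemma norm_axis (n : ℕ) (hn : 5 ≤ n) : ‖axis n hn‖ = 1 := by simp [axis]

lemma norm_smul_axis {n : ℕ} (hn : 5 ≤ n) {r : ℝ} (hr : 0 ≤ r) : ‖r • axis n hn‖ = r := by
  rw [norm_smul, norm_axis, mul_one, Real.norm_of_nonneg hr]

/-- The radial profile of an eigenfunction. -/
lemma radialPair_of_mem_eigenspace {n : ℕ} (hn : 5 ≤ n) {R ν : ℝ} (hR : 0 < R)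
    {ψ : EuclideanSpace ℝ (Fin n) → ℝ} (hψ : ψ ∈ eigenspace n R ν) :
    RadialPair n R (fun r => ψ (r • axis n hn))
      (fun r => -((radialPotential n r + ν) * ψ (r • axis n hn))) := by
  obtain ⟨c, hC, hrad, hz, heq⟩ := hψ
  have cV := continuous_radialPotential hn
  have cf : Continuous fun r : ℝ => ψ (r • axis n hn) :=
    c.comp (continuous_id.smul continuous_const)
  -- The Laplacian is read off from the equation; this expression is continuous on the whole line
  -- although ψ is C² only inside the ball.
  set h : ℝ → ℝ := fun r => -((radialPotential n r + ν) * ψ (r • axis n hn)) with hh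
  have ch : Continuous h := by fun_prop
  refine ⟨cf, ch, fun r hr => hz _ ?_, fun r hr => ?_⟩
  · rw [norm_smul_axis hn (hR.le.trans hr)]; exact hr
  have hmem : ∀ x ∈ Ico 0 R, x • axis n hn ∈ Metric.ball (0 : EuclideanSpace ℝ (Fin n)) R := by
    intro x hx
    rw [mem_ball_zero_iff, norm_smul_axis hn hx.1]
    exact hx.2
  -- The profile in t = |y|²; the square root makes it C² only for t > 0, so the origin is treated
  -- separately through G.
  set F : ℝ → ℝ := fun t => ψ (√t • axis n hn) with hF
  have hFψ : ψ = fun y => F (‖y‖ ^ 2) := by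
    ext y
    refine hrad _ _ ?_
    rw [Real.sqrt_sq (norm_nonneg y), norm_smul_axis hn (norm_nonneg y)]
  have hFC : ∀ t ∈ Ioo 0 (R ^ 2), ContDiffAt ℝ 2 F t := by
    intro t ht
    have hsq : ContDiffAt ℝ 2 (fun t : ℝ => √t • axis n hn) t :=
      (Real.contDiffAt_sqrt ht.1.ne').smul contDiffAt_const
    have : ContDiffAt ℝ 2 ψ (√t • axis n hn) :=
      hC.contDiffAt (Metric.isOpen_ball.mem_nhds (hmem _ ⟨Real.sqrt_nonneg _, by
        rw [Real.sqrt_lt' hR]; exact ht.2⟩))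
    exact this.comp t hsq
  have hsqmem : ∀ x ∈ Ioo 0 R, x ^ 2 ∈ Ioo 0 (R ^ 2) := fun x hx =>
    ⟨by have := hx.1; positivity, pow_lt_pow_left₀ hx.2 hx.1.le (by norm_num)⟩
  have hF1 : ∀ t ∈ Ioo 0 (R ^ 2), HasDerivAt F (deriv F t) t := fun t ht =>
    ((hFC t ht).differentiableAt (by norm_num)).hasDerivAt
  have hF2 : ∀ t ∈ Ioo 0 (R ^ 2), HasDerivAt (deriv F) (deriv (deriv F) t) t := fun t ht =>
    (((ContDiffOn.deriv_of_isOpen (m := 1) (n := 2) (fun t ht => (hFC t ht).contDiffWithinAt)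
      isOpen_Ioo (by norm_num)).contDiffAt (isOpen_Ioo.mem_nhds ht)).differentiableAt
        (by norm_num)).hasDerivAt
  have hode : ∀ x ∈ Ioo 0 R, 4 * x ^ 2 * deriv (deriv F) (x ^ 2) + 2 * n * deriv F (x ^ 2) = h x := by
    intro x hx
    have h1 := laplacian_comp_normSq (n := n) (F := F) (F1 := deriv F)
      (F2 := deriv (deriv F) (x ^ 2)) (x • axis n hn)
    rw [norm_smul_axis hn hx.1.le, ← hFψ] at h1
    have h2 := h1 (by filter_upwards [isOpen_Ioo.mem_nhds (hsqmem x hx)] with t ht using hF1 t ht)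
      (hF2 _ (hsqmem x hx))
    have h3 := heq _ (hmem x ⟨hx.1.le, hx.2⟩)
    rw [potential_eq_radialPotential hn, norm_smul_axis hn hx.1.le] at h3
    rw [← h2]
    simp only [hh]
    linarith
  have hf' : ∀ x ∈ Ioo 0 R, HasDerivAt (fun r : ℝ => ψ (r • axis n hn))
      (deriv F (x ^ 2) * (2 * x)) x := by
    intro x hx
    have h1 : HasDerivAt (fun y : ℝ => F (y ^ 2)) (deriv F (x ^ 2) * (2 * x)) x := by
      have := HasDerivAt.comp (h := fun x : ℝ => x ^ 2) x (hF1 _ (hsqmem x hx)) (hasDerivAt_pow 2 x)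
      refine this.congr_deriv ?_
      push_cast; ring
    refine h1.congr_of_eventuallyEq ?_
    filter_upwards [isOpen_Ioo.mem_nhds hx] with y hy
    simp [hF, Real.sqrt_sq hy.1.le]
  -- Written with `fderiv ℝ ψ`, the function r^(n-1) f' is visibly continuous at 0 with value 0,
  -- which identifies it with the flux.
  set G : ℝ → ℝ := fun x => x ^ (n - 1) * fderiv ℝ ψ (x • axis n hn) (axis n hn) with hG
  have hGd : ∀ x ∈ Ioo 0 R, G x = x ^ (n - 1) * (deriv F (x ^ 2) * (2 * x)) := by
    intro x hx
    have h1 : HasFDerivAt ψ (fderiv ℝ ψ (x • axis n hn)) (x • axis n hn) :=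
      ((hC.contDiffAt (Metric.isOpen_ball.mem_nhds (hmem x ⟨hx.1.le, hx.2⟩))).differentiableAt
        (by norm_num)).hasFDerivAt
    have h2 := h1.comp_hasDerivAt x ((hasDerivAt_id x).smul_const (axis n hn))
    have h3 := h2.unique (hf' x hx)
    simp only [one_smul] at h3
    simp only [hG, h3]
  have hn1 : n = n - 1 + 1 := by omega
  have hGc : ContinuousOn G (Icc 0 r) := by
    refine ContinuousOn.mul (by fun_prop) ?_
    have h1 : ContinuousOn (fderiv ℝ ψ) (Metric.ball 0 R) :=
      hC.continuousOn_fderiv_of_isOpen Metric.isOpen_ball (by norm_num)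
    have h2 : ContinuousOn (fun x : ℝ => fderiv ℝ ψ (x • axis n hn)) (Icc 0 r) :=
      h1.comp (by fun_prop) fun x hx => hmem x ⟨hx.1, hx.2.trans_lt hr.2⟩
    exact h2.clm_apply continuousOn_const
  have hGder : ∀ x ∈ Ioo 0 r, HasDerivAt G (x ^ (n - 1) * h x) x := by
    intro x hx
    have hxR : x ∈ Ioo 0 R := ⟨hx.1, hx.2.trans hr.2⟩
    have h1 : HasDerivAt (fun x => x ^ (n - 1) * (deriv F (x ^ 2) * (2 * x)))
        (x ^ (n - 1) * h x) x := by
      have h2 := HasDerivAt.comp (h := fun x : ℝ => x ^ 2) x (hF2 _ (hsqmem x hxR)) (hasDerivAt_pow 2 x)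
      have h3 := ((hasDerivAt_pow n x).mul h2).const_mul 2
      rw [← hode x hxR]
      have h4 : (fun x => x ^ (n - 1) * (deriv F (x ^ 2) * (2 * x))) =
          fun x => 2 * (x ^ n * deriv F (x ^ 2)) := by
        ext x
        nth_rw 2 [hn1]
        ring
      rw [h4]
      refine h3.congr_deriv ?_
      simp only [Function.comp]
      rw [show x ^ n = x ^ (n - 1) * x by rw [← pow_succ, ← hn1]]
      push_cast
      ring
    refine h1.congr_of_eventuallyEq ?_
    filter_upwards [isOpen_Ioo.mem_nhds hxR] with y hy using hGd y hy
  have hflux : flux n h r = G r := by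
    have := integral_eq_sub_of_hasDerivAt_of_le hr.1.le hGc hGder
      ((by fun_prop : Continuous _).intervalIntegrable _ _)
    have hG0 : G 0 = 0 := by
      simp only [hG]
      rw [zero_pow (by omega), zero_mul]
    rw [flux, this, hG0, sub_zero]
  refine (hf' r hr).congr_deriv ?_
  rw [hflux, hGd r hr, mul_div_cancel_left₀ _ (pow_pos hr.1 _).ne']

/-- The sum of the eigenspaces with eigenvalue at most `M`. -/
abbrev spectralSpace (n : ℕ) (R M : ℝ) : Submodule ℝ (EuclideanSpace ℝ (Fin n) → ℝ) :=
  ⨆ ν : Set.Iic M, eigenspace n R ν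

lemma spectralSpace_mono (n : ℕ) (R : ℝ) {M M' : ℝ} (h : M ≤ M') :
    spectralSpace n R M ≤ spectralSpace n R M' :=
  iSup_le fun ν => le_iSup (fun ν : Set.Iic M' => eigenspace n R ν) ⟨ν, ν.2.trans h⟩

/-- Eigenfunctions for different eigenvalues are orthogonal. -/
lemma integral_mul_eq_zero {n : ℕ} (hn : 5 ≤ n) {R ν ν' : ℝ} (hR : 0 < R) (hν : ν ≠ ν')
    {ψ ψ' : EuclideanSpace ℝ (Fin n) → ℝ} (hψ : ψ ∈ eigenspace n R ν)
    (hψ' : ψ' ∈ eigenspace n R ν') :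
    ∫ x in (0 : ℝ)..R, x ^ (n - 1) * (ψ (x • axis n hn) * ψ' (x • axis n hn)) = 0 := by
  have h := (radialPair_of_mem_eigenspace hn hR hψ).green hR
    (radialPair_of_mem_eigenspace hn hR hψ')
  have h1 : (ν' - ν) * ∫ x in (0 : ℝ)..R,
      x ^ (n - 1) * (ψ (x • axis n hn) * ψ' (x • axis n hn)) = 0 := by
    rw [← intervalIntegral.integral_const_mul]
    refine Eq.trans (intervalIntegral.integral_congr fun x _ => ?_) h
    ring
  exact (mul_eq_zero.1 h1).resolve_left (sub_ne_zero.2 hν.symm)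

lemma integral_sq_pos {n : ℕ} {R : ℝ} (hR : 0 < R) {f : ℝ → ℝ} (hf : Continuous f)
    {r : ℝ} (hr : r ∈ Icc 0 R) (hfr : f r ≠ 0) :
    0 < ∫ x in (0 : ℝ)..R, x ^ (n - 1) * f x ^ 2 := by
  obtain ⟨c, hc, hfc⟩ : ∃ c ∈ Ioo 0 R, f c ≠ 0 := by
    by_contra! hcon
    have : EqOn f 0 (closure (Ioo 0 R)) :=
      EqOn.closure (fun x hx => hcon x hx) hf continuous_zero
    rw [closure_Ioo hR.ne] at this
    exact hfr (this hr)
  refine intervalIntegral.integral_pos hR (by fun_prop) (fun x hx => ?_)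
    ⟨c, Ioo_subset_Icc_self hc, ?_⟩
  · have := hx.1.le
    positivity
  · have := hc.1
    positivity

/-- Nonzero eigenfunctions have positive norm. -/
lemma integral_sq_pos_of_mem {n : ℕ} (hn : 5 ≤ n) {R : ℝ} (hR : 0 < R)
    {ψ : EuclideanSpace ℝ (Fin n) → ℝ} (hc : Continuous ψ)
    (hrad : ∀ x y, ‖x‖ = ‖y‖ → ψ x = ψ y) (hz : ∀ x, R ≤ ‖x‖ → ψ x = 0) (h0 : ψ ≠ 0) :
    0 < ∫ x in (0 : ℝ)..R, x ^ (n - 1) * ψ (x • axis n hn) ^ 2 := by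
  obtain ⟨y, hy⟩ := Function.ne_iff.1 h0
  refine integral_sq_pos hR (f := fun x => ψ (x • axis n hn)) (r := ‖y‖)
    (hc.comp (continuous_id.smul continuous_const)) ⟨norm_nonneg y, ?_⟩ ?_
  · by_contra! hlt
    exact hy (hz y hlt.le)
  · rwa [hrad _ y (norm_smul_axis hn (norm_nonneg y))]

/-- Pairing a linear relation with ψ j kills every other term by orthogonality. -/
lemma linearIndependent_eigenfunctions {n : ℕ} (hn : 5 ≤ n) {R : ℝ} (hR : 0 < R) {ι : Type*}
    {ν : ι → ℝ} (hν : Function.Injective ν) {ψ : ι → EuclideanSpace ℝ (Fin n) → ℝ}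
    (hψ : ∀ i, ψ i ∈ eigenspace n R (ν i)) (h0 : ∀ i, ψ i ≠ 0) : LinearIndependent ℝ ψ := by
  rw [linearIndependent_iff']
  intro s c hc j hj
  have cont : ∀ i, Continuous fun x : ℝ => ψ i (x • axis n hn) := fun i =>
    (hψ i).1.comp (continuous_id.smul continuous_const)
  have contm : ∀ i j, Continuous fun x : ℝ =>
      x ^ (n - 1) * (ψ i (x • axis n hn) * ψ j (x • axis n hn)) := fun i j =>
    (continuous_id.pow (n - 1)).mul ((cont i).mul (cont j))
  have h1 : ∫ x in (0 : ℝ)..R, ∑ i ∈ s,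
      c i * (x ^ (n - 1) * (ψ i (x • axis n hn) * ψ j (x • axis n hn))) = 0 := by
    suffices h : ∀ x : ℝ, ∑ i ∈ s,
        c i * (x ^ (n - 1) * (ψ i (x • axis n hn) * ψ j (x • axis n hn))) = 0 by
      simp only [h, intervalIntegral.integral_zero]
    intro x
    have h2 := congrFun hc (x • axis n hn)
    simp only [Finset.sum_apply, Pi.smul_apply, smul_eq_mul, Pi.zero_apply] at h2
    calc _ = x ^ (n - 1) * (∑ i ∈ s, c i * ψ i (x • axis n hn)) * ψ j (x • axis n hn) := by
          rw [Finset.mul_sum, Finset.sum_mul]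
          exact Finset.sum_congr rfl fun i _ => by ring
      _ = 0 := by rw [h2]; ring
  rw [intervalIntegral.integral_finsetSum fun i _ =>
    ((contm i j).const_mul _).intervalIntegrable _ _] at h1
  simp only [intervalIntegral.integral_const_mul] at h1
  rw [Finset.sum_eq_single j (fun i _ hij => by
    rw [integral_mul_eq_zero hn hR (hν.ne hij) (hψ i) (hψ j), mul_zero]) (fun h => absurd hj h)] at h1
  refine (mul_eq_zero.1 h1).resolve_right ?_
  have := integral_sq_pos_of_mem hn hR (hψ j).1 (hψ j).2.2.1 (hψ j).2.2.2.1 (h0 j)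
  simp only [sq] at this
  exact this.ne'

/-- On the sum of the eigenspaces up to `M`, the quadratic form is at most `M` times the norm. -/
lemma exists_radialPair_of_mem_spectralSpace {n : ℕ} (hn : 5 ≤ n) {R M : ℝ} (hR : 0 < R)
    {u : EuclideanSpace ℝ (Fin n) → ℝ} (hu : u ∈ spectralSpace n R M) :
    Continuous u ∧ (∀ x y, ‖x‖ = ‖y‖ → u x = u y) ∧ (∀ x, R ≤ ‖x‖ → u x = 0) ∧
    ∃ h, RadialPair n R (fun r => u (r • axis n hn)) h ∧
      ∫ x in (0 : ℝ)..R, x ^ (n - 1) * (u (x • axis n hn) *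
        -(h x + radialPotential n x * u (x • axis n hn))) ≤
      M * ∫ x in (0 : ℝ)..R, x ^ (n - 1) * u (x • axis n hn) ^ 2 := by
  obtain ⟨ψ, hψ, hsum⟩ := (Submodule.mem_iSup_iff_exists_finsupp _ _).1 hu
  set s := ψ.support
  have hux : ∀ x, u x = ∑ i ∈ s, ψ i x := fun x => by
    rw [← hsum, Finsupp.sum, Finset.sum_apply]
  have cont : ∀ i, Continuous fun x : ℝ => ψ i (x • axis n hn) := fun i =>
    (hψ i).1.comp (continuous_id.smul continuous_const)
  refine ⟨?_, fun x y hxy => ?_, fun x hx => ?_,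
    fun r => ∑ i ∈ s, -((radialPotential n r + i) * ψ i (r • axis n hn)), ?_, ?_⟩
  · rw [funext hux]
    exact continuous_finsetSum _ fun i _ => (hψ i).1
  · rw [hux, hux]
    exact Finset.sum_congr rfl fun i _ => (hψ i).2.2.1 x y hxy
  · rw [hux]
    exact Finset.sum_eq_zero fun i _ => (hψ i).2.2.2.1 x hx
  · simp only [hux]
    exact RadialPair.sum s fun i _ => radialPair_of_mem_eigenspace hn hR (hψ i)
  · set I : Set.Iic M → Set.Iic M → ℝ := fun i j =>
      ∫ x in (0 : ℝ)..R, x ^ (n - 1) * (ψ i (x • axis n hn) * ψ j (x • axis n hn)) with hI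
    have hI0 : ∀ i j, i ≠ j → I i j = 0 := fun i j hij =>
      integral_mul_eq_zero hn hR (fun h => hij (Subtype.ext h)) (hψ i) (hψ j)
    have hII : ∀ i, 0 ≤ I i i := fun i => by
      refine intervalIntegral.integral_nonneg hR.le fun x hx => ?_
      have := hx.1
      have := mul_self_nonneg (ψ i (x • axis n hn))
      positivity
    have contm : ∀ i j, Continuous fun x : ℝ =>
        x ^ (n - 1) * (ψ i (x • axis n hn) * ψ j (x • axis n hn)) := fun i j =>
      (continuous_id.pow (n - 1)).mul ((cont i).mul (cont j))
    -- Orthogonality leaves only the diagonal of the double sum; c i = i gives the quadratic form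
    -- and c i = 1 the norm.
    have key : ∀ c : Set.Iic M → ℝ, (∫ x in (0 : ℝ)..R, x ^ (n - 1) *
        ((∑ j ∈ s, ψ j (x • axis n hn)) * ∑ i ∈ s, c i * ψ i (x • axis n hn))) =
        ∑ i ∈ s, c i * I i i := by
      intro c
      have e1 : ∀ x : ℝ, x ^ (n - 1) *
        ((∑ j ∈ s, ψ j (x • axis n hn)) * ∑ i ∈ s, c i * ψ i (x • axis n hn)) =
          ∑ i ∈ s, ∑ j ∈ s,
            c i * (x ^ (n - 1) * (ψ i (x • axis n hn) * ψ j (x • axis n hn))) := by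
        intro x
        rw [mul_comm (∑ j ∈ s, ψ j (x • axis n hn)), Finset.sum_mul_sum, Finset.mul_sum]
        refine Finset.sum_congr rfl fun i _ => ?_
        rw [Finset.mul_sum]
        exact Finset.sum_congr rfl fun j _ => by ring
      simp only [e1]
      rw [intervalIntegral.integral_finsetSum fun i _ =>
        (continuous_finsetSum _ fun j _ => (contm i j).const_mul _).intervalIntegrable _ _]
      refine Finset.sum_congr rfl fun i hi => ?_
      rw [intervalIntegral.integral_finsetSum fun j _ => ((contm i j).const_mul _).intervalIntegrable _ _]
      simp only [intervalIntegral.integral_const_mul]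
      rw [Finset.sum_eq_single i (fun j _ hij => by
        have := hI0 i j hij.symm
        simp only [hI] at this
        rw [this, mul_zero]) (fun h => absurd hi h)]
    have k1 := key fun i => (i : ℝ)
    have k2 := key fun _ => 1
    calc _ = ∑ i ∈ s, (i : ℝ) * I i i := by
          rw [← k1]
          refine intervalIntegral.integral_congr fun x _ => ?_
          simp only [hux]
          congr 2
          rw [Finset.mul_sum, ← Finset.sum_add_distrib, ← Finset.sum_neg_distrib]
          exact Finset.sum_congr rfl fun i _ => by ring
      _ ≤ ∑ i ∈ s, M * (1 * I i i) := Finset.sum_le_sum fun i _ => by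
          rw [one_mul]
          exact mul_le_mul_of_nonneg_right i.2 (hII i)
      _ = _ := by
          rw [← Finset.mul_sum, ← k2]
          congr 1
          refine intervalIntegral.integral_congr fun x _ => ?_
          simp only [hux, one_mul, sq]

/-! ### Counting eigenvalues with barriers -/

/-- Covers the degenerate intervals that arise when R is smaller than a cut radius. -/
lemma hasBarrier_self (n : ℕ) (V : ℝ → ℝ) (l α : ℝ) : HasBarrier n V l α α :=
  ⟨fun _ => 1, fun _ => 0, fun _ => 0, continuousOn_const, continuousOn_const,
    fun _ _ => one_pos, fun _ => rfl, by simp, by simp, by simp⟩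

/-- If `[0, R]` is cut at `m` points into intervals with barriers at level `l > M`, at most `m`
eigenvalues are `≤ M`. -/
lemma rank_spectralSpace_le {n : ℕ} (hn : 5 ≤ n) {R M l : ℝ} (hR : 0 < R) (m : ℕ) (a : ℕ → ℝ)
    (a0 : a 0 = 0) (aR : a (m + 1) = R) (hmono : ∀ i ≤ m, a i ≤ a (i + 1))
    (hb : ∀ i ≤ m, HasBarrier n (radialPotential n) l (a i) (a (i + 1))) (hl : M < l) :
    Module.rank ℝ (spectralSpace n R M) ≤ m := by
  have hmono' : MonotoneOn a (Icc 0 (m + 1)) := by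
    intro i hi j hj hij
    induction j, hij using Nat.le_induction with
    | base => exact le_rfl
    | succ j hij ih =>
      have : j ≤ m := Nat.succ_le_succ_iff.1 hj.2
      exact (ih ⟨Nat.zero_le _, by omega⟩).trans (hmono j this)
  -- An element of the kernel vanishes at every cut point, so Picone applies on each piece; summing
  -- gives l‖u‖² ≤ M‖u‖² with M < l, hence u = 0.
  let ev : spectralSpace n R M →ₗ[ℝ] (Fin m → ℝ) :=
    { toFun := fun u i => u.1 (a (i + 1) • axis n hn)
      map_add' := fun _ _ => rfl
      map_smul' := fun _ _ => rfl }
  have hinj : Function.Injective ev := by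
    rw [injective_iff_map_eq_zero]
    rintro ⟨u, hu⟩ hev
    by_contra hne
    have hu0 : u ≠ 0 := fun h => hne (Subtype.ext h)
    obtain ⟨hc, hrad, hz, h, hpair, hle⟩ := exists_radialPair_of_mem_spectralSpace hn hR hu
    have hpos := integral_sq_pos_of_mem hn hR hc hrad hz hu0
    have hzero : ∀ i ≤ m, u (a (i + 1) • axis n hn) = 0 := by
      intro i hi
      rcases hi.lt_or_eq with hi | rfl
      · exact congrFun hev ⟨i, hi⟩
      · exact hpair.eq_zero _ aR.ge
    have cV := continuous_radialPotential hn
    have := hpair.cont; have := hpair.cont_lap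
    have hpic : ∀ i ∈ Finset.range (m + 1),
        l * ∫ x in a i..a (i + 1), x ^ (n - 1) * u (x • axis n hn) ^ 2 ≤
        ∫ x in a i..a (i + 1), x ^ (n - 1) * (u (x • axis n hn) *
        -(h x + radialPotential n x * u (x • axis n hn))) := by
      intro i hi
      have him : i ≤ m := Nat.lt_succ_iff.1 (Finset.mem_range.1 hi)
      refine hpair.picone cV ?_ (hmono i him) ?_ ?_ (hzero i him) (hb i him)
      · rw [← a0]
        exact hmono' ⟨le_rfl, by omega⟩ ⟨by omega, by omega⟩ (Nat.zero_le _)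
      · rw [← aR]
        exact hmono' ⟨by omega, by omega⟩ ⟨by omega, le_rfl⟩ (by omega)
      · rcases i with _ | i
        · exact Or.inl a0
        · exact Or.inr (hzero i (by omega))
    have hsum := Finset.sum_le_sum hpic
    rw [← Finset.mul_sum, intervalIntegral.sum_integral_adjacent_intervals fun k _ =>
      (by fun_prop : Continuous _).intervalIntegrable _ _,
      intervalIntegral.sum_integral_adjacent_intervals fun k _ =>
      (by fun_prop : Continuous _).intervalIntegrable _ _, a0, aR] at hsum
    nlinarith [hsum.trans hle]
  simpa using LinearMap.rank_le_of_injective ev hinj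

/-- On short intervals there is a barrier at any level. -/
lemma hasBarrier_of_short {n : ℕ} (hn : 5 ≤ n) {l α β : ℝ} (hα : 0 ≤ α)
    (hshort : (critExp n + |l|) * (β - α) ^ 2 ≤ 1) :
    HasBarrier n (radialPotential n) l α β := by
  -- The barrier is 1 - K(r-α)². The hypothesis keeps it at least 1/2; its second derivative
  -- contributes 2K ≥ V + l, and the first-order term has the favourable sign because the barrier
  -- decreases.
  set K := (critExp n + |l|) / 2 with hK
  have hp := critExp_pos hn
  have hK0 : 0 ≤ K := by positivity
  have hsmall : ∀ r ∈ Icc α β, K * (r - α) ^ 2 ≤ 1 / 2 := by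
    intro r hr
    have : (r - α) ^ 2 ≤ (β - α) ^ 2 :=
      pow_le_pow_left₀ (by linarith [hr.1]) (by linarith [hr.2]) 2
    nlinarith
  refine ⟨fun r => 1 - K * (r - α) ^ 2, fun r => -(2 * K) * (r ^ (n - 1) * (r - α)),
    fun r => -(2 * K) * (1 + (n - 1 : ℕ) * (r - α) / r), by fun_prop, by fun_prop,
    fun r hr => ?_, fun h => ?_, fun r hr => ?_, fun r hr => ?_, fun r hr => ?_⟩
  · linarith [hsmall r hr]
  · rw [h]; simp
  · have hr0 : r ^ (n - 1) ≠ 0 := (pow_pos (hα.trans_lt hr.1) _).ne'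
    have h1 := (((hasDerivAt_id r).sub_const α).pow 2 |>.const_mul K).const_sub 1
    refine h1.congr_deriv ?_
    field_simp
    simp
  · have hr0 : r ≠ 0 := (hα.trans_lt hr.1).ne'
    have h1 := ((hasDerivAt_pow (n - 1) r).mul ((hasDerivAt_id r).sub_const α)).const_mul (-(2 * K))
    refine h1.congr_deriv ?_
    have : r ^ (n - 1) = r ^ (n - 1 - 1) * r := by rw [← pow_succ]; congr 1; omega
    rw [this]
    simp only [id]
    field_simp
    ring
  · have hr0 : 0 < r := hα.trans_lt hr.1
    have h1 := hsmall r (Ioo_subset_Icc_self hr)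
    have h2 : 0 ≤ ((n - 1 : ℕ) : ℝ) * (r - α) / r := by
      have := sub_pos.2 hr.1
      positivity
    have h3 := radialPotential_le hn r
    have h4 := (radialPotential_pos hn r).le
    have h5 : 0 ≤ K * (r - α) ^ 2 := by positivity
    have h6 := le_abs_self l
    have h7 : (radialPotential n r + l) * (1 - K * (r - α) ^ 2) ≤ 2 * K := by
      calc _ ≤ (critExp n + |l|) * (1 - K * (r - α) ^ 2) :=
            mul_le_mul_of_nonneg_right (by linarith) (by linarith)
        _ ≤ (critExp n + |l|) * 1 := mul_le_mul_of_nonneg_left (by linarith) (by positivity)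
        _ = 2 * K := by rw [hK]; ring
    nlinarith [mul_nonneg hK0 h2]

/-- Equal pieces of length R/(m+1) are short enough for `hasBarrier_of_short` at level M + 1 once m
> C R². -/
lemma exists_rank_spectralSpace_le {n : ℕ} (hn : 5 ≤ n) {R : ℝ} (hR : 0 < R) (M : ℝ) :
    ∃ m : ℕ, Module.rank ℝ (spectralSpace n R M) ≤ m := by
  have hp := critExp_pos hn
  set C := critExp n + |M + 1| with hC
  have hC0 : 0 < C := by positivity
  obtain ⟨m, hm⟩ := exists_nat_gt (max 1 (C * R ^ 2))
  have hm1 : (1 : ℝ) < m := (le_max_left _ _).trans_lt hm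
  have hm2 : C * R ^ 2 < m := (le_max_right _ _).trans_lt hm
  refine ⟨m, rank_spectralSpace_le hn hR m (fun i => i * (R / (m + 1))) (by simp) ?_ ?_ ?_
    (lt_add_one M)⟩
  · push_cast
    field_simp
  · intro i _
    push_cast
    have : 0 < R / (m + 1) := by positivity
    linarith
  · intro i _
    have hd : 0 < R / (m + 1) := by positivity
    refine hasBarrier_of_short hn (by positivity) ?_
    have e : ((i + 1 : ℕ) : ℝ) * (R / (m + 1)) - i * (R / (m + 1)) = R / (m + 1) := by
      push_cast; ring
    rw [e, div_pow, ← mul_div_assoc, div_le_one (by positivity)]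
    nlinarith

lemma finite_eigenvalues_le {n : ℕ} (hn : 5 ≤ n) {R : ℝ} (hR : 0 < R) (M : ℝ) :
    {ν | ν ≤ M ∧ eigenspace n R ν ≠ ⊥}.Finite := by
  obtain ⟨m, hm⟩ := exists_rank_spectralSpace_le hn hR M
  have hex : ∀ i : {ν | ν ≤ M ∧ eigenspace n R ν ≠ ⊥}, ∃ ψ ∈ eigenspace n R i.1, ψ ≠ 0 := fun i =>
    (Submodule.ne_bot_iff _).1 i.2.2
  choose ψ hψ h0 using hex
  have hli := linearIndependent_eigenfunctions hn hR Subtype.val_injective hψ h0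
  have hmem : ∀ i, ψ i ∈ spectralSpace n R M := fun i =>
    (le_iSup (fun ν : Set.Iic M => eigenspace n R ν) ⟨i.1, i.2.1⟩) (hψ i)
  have hli' : LinearIndependent ℝ fun i => (⟨ψ i, hmem i⟩ : spectralSpace n R M) :=
    LinearIndependent.of_comp (spectralSpace n R M).subtype hli
  have := hli'.cardinal_le_rank.trans hm
  exact Cardinal.lt_aleph0_iff_set_finite.1 (this.trans_lt (Cardinal.natCast_lt_aleph0))

/-- If there are `i` different eigenvalues then the `i`-th eigenvalue exists. -/
lemma exists_isNthEigenvalue {n : ℕ} (hn : 5 ≤ n) {R : ℝ} (hR : 0 < R) {i : ℕ} (hi : 0 < i)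
    (ν : Fin i → ℝ) (hν : Function.Injective ν) (hE : ∀ j, eigenspace n R (ν j) ≠ ⊥) :
    ∃ μ, IsNthEigenvalue n R i μ := by
  have : Nonempty (Fin i) := ⟨⟨0, hi⟩⟩
  obtain ⟨j0, hj0⟩ := Finite.exists_max ν
  have hex : ∀ j, ∃ ψ ∈ eigenspace n R (ν j), ψ ≠ 0 := fun j => (Submodule.ne_bot_iff _).1 (hE j)
  choose ψ hψ h0 using hex
  have hrank : (i : Cardinal) ≤ Module.rank ℝ (spectralSpace n R (ν j0)) := by
    have hli := linearIndependent_eigenfunctions hn hR hν hψ h0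
    have hmem : ∀ j, ψ j ∈ spectralSpace n R (ν j0) := fun j =>
      (le_iSup (fun e : Set.Iic (ν j0) => eigenspace n R e) ⟨ν j, hj0 j⟩) (hψ j)
    have hli' : LinearIndependent ℝ fun j => (⟨ψ j, hmem j⟩ : spectralSpace n R (ν j0)) :=
      LinearIndependent.of_comp (spectralSpace n R (ν j0)).subtype hli
    simpa using hli'.cardinal_le_rank
  set S := {e | e ≤ ν j0 ∧ eigenspace n R e ≠ ⊥ ∧
    (i : Cardinal) ≤ Module.rank ℝ (spectralSpace n R e)} with hS
  have hSfin : S.Finite := (finite_eigenvalues_le hn hR (ν j0)).subset fun e he => ⟨he.1, he.2.1⟩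
  -- The smallest eigenvalue at which the total multiplicity reaches i.
  obtain ⟨μ, hμ, hmin⟩ := Set.exists_min_image S id hSfin ⟨ν j0, le_rfl, hE j0, hrank⟩
  refine ⟨μ, ?_, hμ.2.2⟩
  set T := {e | e < μ ∧ eigenspace n R e ≠ ⊥}
  have hTfin : T.Finite := (finite_eigenvalues_le hn hR μ).subset fun e he => ⟨he.1.le, he.2⟩
  rcases T.eq_empty_or_nonempty with hT | hT
  · have : (⨆ e : Set.Iio μ, eigenspace n R e) = ⊥ := by
      refine iSup_eq_bot.2 fun e => ?_
      by_contra hne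
      have : e.1 ∈ T := ⟨e.2, hne⟩
      rw [hT] at this
      exact this
    rw [this, rank_bot]
    exact_mod_cast hi
  · obtain ⟨e, he, hmax⟩ := Set.exists_max_image T id hTfin hT
    have hle : (⨆ e : Set.Iio μ, eigenspace n R e) ≤ spectralSpace n R e := by
      refine iSup_le fun e' => ?_
      by_cases hb : eigenspace n R e' = ⊥
      · rw [hb]; exact bot_le
      · exact le_iSup (fun x : Set.Iic e => eigenspace n R x) ⟨e'.1, hmax e'.1 ⟨e'.2, hb⟩⟩
    -- If the eigenvalues below μ already had multiplicity i, the largest of them, e, would lie in S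
    -- and contradict minimality.
    refine (Submodule.rank_mono hle).trans_lt (not_le.1 fun hcon => ?_)
    have : μ ≤ e := hmin e ⟨he.1.le.trans hμ.1, he.2, hcon⟩
    exact absurd he.1 (not_lt.2 this)

/-! ### The three barriers, in the variable x = |y|² / (n(n-2)) -/

/-- The operator `F ↦ -(4 x F'' + 2 n F' + n (n + 2) F / (1 + x)²)`, which is `-(Δ + V)` in the
variable `x = |y|² / (n (n - 2))`, up to a factor. -/
def normalizedOp (n : ℕ) (F F1 F2 : ℝ → ℝ) (x : ℝ) : ℝ :=
  -(4 * x * F2 x + 2 * n * F1 x + n * (n + 2) * F x / (1 + x) ^ 2)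

lemma radialPotential_eq_normalized {n : ℕ} (hn : 5 ≤ n) (r : ℝ) :
    radialPotential n r = 1 / ((n : ℝ) * ((n : ℝ) - 2)) * (n * (n + 2)) /
      (1 + 1 / ((n : ℝ) * ((n : ℝ) - 2)) * r ^ 2) ^ 2 := by
  have hn' : (5 : ℝ) ≤ n := by exact_mod_cast hn
  have h2 : (n : ℝ) - 2 ≠ 0 := by linarith
  unfold radialPotential critExp
  congr 1
  field_simp

/-- A positive supersolution in the normalized variable gives a barrier. -/
lemma hasBarrier_of_normalized {n : ℕ} (hn : 5 ≤ n) {κ l α β : ℝ}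
    (hκ : κ = 1 / ((n : ℝ) * ((n : ℝ) - 2))) (hα : 0 ≤ α) {F F1 F2 : ℝ → ℝ}
    (h1 : ∀ x ∈ Icc (κ * α ^ 2) (κ * β ^ 2), HasDerivAt F (F1 x) x)
    (h2 : ∀ x ∈ Icc (κ * α ^ 2) (κ * β ^ 2), HasDerivAt F1 (F2 x) x)
    (h3 : ∀ x ∈ Icc (κ * α ^ 2) (κ * β ^ 2), 0 < F x)
    (h4 : ∀ x ∈ Icc (κ * α ^ 2) (κ * β ^ 2), l * F x ≤ κ * normalizedOp n F F1 F2 x) :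
    HasBarrier n (radialPotential n) l α β := by
  have hκ0 : 0 < κ := by rw [hκ]; exact one_div_pos.2 (mul_sub_two_pos hn)
  have hmem : ∀ r ∈ Icc α β, κ * r ^ 2 ∈ Icc (κ * α ^ 2) (κ * β ^ 2) := fun r hr =>
    ⟨mul_le_mul_of_nonneg_left (pow_le_pow_left₀ hα hr.1 2) hκ0.le,
      mul_le_mul_of_nonneg_left (pow_le_pow_left₀ (hα.trans hr.1) hr.2 2) hκ0.le⟩
  have hsq : ∀ r : ℝ, HasDerivAt (fun r : ℝ => κ * r ^ 2) (κ * (2 * r)) r := fun r => by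
    simpa using (hasDerivAt_pow 2 r).const_mul κ
  have d1 : ∀ r ∈ Icc α β, HasDerivAt (fun r => F (κ * r ^ 2)) (F1 (κ * r ^ 2) * (κ * (2 * r))) r :=
    fun r hr => HasDerivAt.comp (h := fun r : ℝ => κ * r ^ 2) r (h1 _ (hmem r hr)) (hsq r)
  have d2 : ∀ r ∈ Icc α β, HasDerivAt (fun r => F1 (κ * r ^ 2)) (F2 (κ * r ^ 2) * (κ * (2 * r))) r :=
    fun r hr => HasDerivAt.comp (h := fun r : ℝ => κ * r ^ 2) r (h2 _ (hmem r hr)) (hsq r)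
  have hpow : ∀ r : ℝ, r ^ n = r ^ (n - 1) * r := fun r => by
    rw [← pow_succ]; congr 1; omega
  refine ⟨fun r => F (κ * r ^ 2), fun r => 2 * κ * (r ^ n * F1 (κ * r ^ 2)),
    fun r => κ * (4 * (κ * r ^ 2) * F2 (κ * r ^ 2) + 2 * n * F1 (κ * r ^ 2)),
    fun r hr => (d1 r hr).continuousAt.continuousWithinAt,
    fun r hr => ((continuousAt_id.pow n).mul (d2 r hr).continuousAt |>.const_mul
      _).continuousWithinAt, fun r hr => h3 _ (hmem r hr), fun _ => ?_, fun r hr => ?_,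
      fun r hr => ?_, fun r hr => ?_⟩
  · simp [show n ≠ 0 by omega]
  · have hr0 : r ^ (n - 1) ≠ 0 := (pow_pos (hα.trans_lt hr.1) _).ne'
    refine (d1 r (Ioo_subset_Icc_self hr)).congr_deriv ?_
    simp only [hpow]
    field_simp
  · have := ((hasDerivAt_pow n r).mul (d2 r (Ioo_subset_Icc_self hr))).const_mul (2 * κ)
    refine this.congr_deriv ?_
    rw [hpow]
    ring
  · have := h4 _ (hmem r (Ioo_subset_Icc_self hr))
    refine this.trans_eq ?_
    rw [radialPotential_eq_normalized hn, ← hκ, normalizedOp]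
    ring

/-- On a compact interval a uniformly strict supersolution gives a barrier at a positive level. -/
lemma exists_hasBarrier_of_normalized {n : ℕ} (hn : 5 ≤ n) {κ δ α β : ℝ}
    (hκ : κ = 1 / ((n : ℝ) * ((n : ℝ) - 2))) (hα : 0 ≤ α) (hδ : 0 < δ) {F F1 F2 : ℝ → ℝ}
    (h1 : ∀ x ∈ Icc (κ * α ^ 2) (κ * β ^ 2), HasDerivAt F (F1 x) x)
    (h2 : ∀ x ∈ Icc (κ * α ^ 2) (κ * β ^ 2), HasDerivAt F1 (F2 x) x)
    (h3 : ∀ x ∈ Icc (κ * α ^ 2) (κ * β ^ 2), 0 < F x)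
    (h4 : ∀ x ∈ Icc (κ * α ^ 2) (κ * β ^ 2), δ ≤ normalizedOp n F F1 F2 x) :
    ∃ l, 0 < l ∧ HasBarrier n (radialPotential n) l α β := by
  have hκ0 : 0 < κ := by rw [hκ]; exact one_div_pos.2 (mul_sub_two_pos hn)
  obtain ⟨C, hC⟩ := isCompact_Icc.exists_bound_of_continuousOn
    (fun x hx => (h1 x hx).continuousAt.continuousWithinAt)
  have hC1 : 0 < max C 1 := lt_max_of_lt_right one_pos
  refine ⟨κ * δ / max C 1, by positivity, hasBarrier_of_normalized hn hκ hα h1 h2 h3 ?_⟩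
  intro x hx
  have h5 : F x ≤ max C 1 := ((le_abs_self _).trans (hC x hx)).trans (le_max_left _ _)
  calc _ = κ * δ * (F x / max C 1) := by ring
    _ ≤ κ * δ * 1 := mul_le_mul_of_nonneg_left ((div_le_one hC1).2 h5) (by positivity)
    _ ≤ _ := by rw [mul_one]; exact mul_le_mul_of_nonneg_left (h4 x hx) hκ0.le

/-- The scaling generator `(1 - x) (1 + x) ^ (-n / 2)`, a multiple of
`(n - 2) / 2 * Q + y · ∇ Q`. -/
def scalingMode (n : ℕ) (x : ℝ) : ℝ := (1 - x) * (1 + x) ^ (-(n : ℝ) / 2)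

/-- The zero mode comes from the scaling invariance of the critical equation solved by Q; here it is
checked by explicit differentiation. -/
lemma exists_deriv_scalingMode (n : ℕ) : ∃ F1 F2 : ℝ → ℝ, ∀ x, 0 ≤ x →
    HasDerivAt (scalingMode n) (F1 x) x ∧ HasDerivAt F1 (F2 x) x ∧
      normalizedOp n (scalingMode n) F1 F2 x = 0 := by
  have hd : ∀ s x : ℝ, 0 ≤ x →
      HasDerivAt (fun x : ℝ => (1 + x) ^ s) (s * (1 + x) ^ (s - 1)) x := by
    intro s x hx
    have := ((hasDerivAt_id x).const_add 1).rpow_const (p := s) (Or.inl (by simp; linarith))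
    simpa using this
  refine ⟨fun x => (-1) * (1 + x) ^ (-(n : ℝ) / 2) +
      (1 - x) * (-(n : ℝ) / 2 * (1 + x) ^ (-(n : ℝ) / 2 - 1)),
    fun x => (-1) * (-(n : ℝ) / 2 * (1 + x) ^ (-(n : ℝ) / 2 - 1)) +
      ((-1) * (-(n : ℝ) / 2 * (1 + x) ^ (-(n : ℝ) / 2 - 1)) +
      (1 - x) * (-(n : ℝ) / 2 * ((-(n : ℝ) / 2 - 1) * (1 + x) ^ (-(n : ℝ) / 2 - 1 - 1)))),
    fun x hx => ⟨?_, ?_, ?_⟩⟩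
  · exact ((hasDerivAt_id x).const_sub 1).mul (hd _ x hx)
  · exact ((hd _ x hx).const_mul (-1)).add
      (((hasDerivAt_id x).const_sub 1).mul ((hd _ x hx).const_mul _))
  · have hx1 : 0 < 1 + x := by linarith
    have e1 : (1 + x) ^ (-(n : ℝ) / 2 - 1) = (1 + x) ^ (-(n : ℝ) / 2) / (1 + x) := by
      rw [Real.rpow_sub hx1, Real.rpow_one]
    have e2 : (1 + x) ^ (-(n : ℝ) / 2 - 1 - 1) = (1 + x) ^ (-(n : ℝ) / 2) / (1 + x) ^ 2 := by
      rw [Real.rpow_sub hx1, Real.rpow_one, e1]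
      field_simp
    simp only [normalizedOp, scalingMode, e1, e2]
    field_simp
    ring

/-- The barrier on a ball on which the scaling mode is positive. -/
lemma exists_hasBarrier_inner {n : ℕ} (hn : 5 ≤ n) {κ ra : ℝ}
    (hκ : κ = 1 / ((n : ℝ) * ((n : ℝ) - 2))) (ha : κ * ra ^ 2 < 1) :
    ∃ l, 0 < l ∧ HasBarrier n (radialPotential n) l 0 ra := by
  have hn' : (5 : ℝ) ≤ n := by exact_mod_cast hn
  have hκ0 : 0 < κ := by rw [hκ]; exact one_div_pos.2 (mul_sub_two_pos hn)
  obtain ⟨F1, F2, hF⟩ := exists_deriv_scalingMode n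
  set I := Icc (κ * 0 ^ 2) (κ * ra ^ 2) with hI
  have hx0 : ∀ x ∈ I, 0 ≤ x := fun x hx => by simpa using hx.1
  have hx1 : ∀ x ∈ I, x < 1 := fun x hx => hx.2.trans_lt ha
  have hne : I.Nonempty := ⟨κ * 0 ^ 2, left_mem_Icc.2 (by simp; positivity)⟩
  obtain ⟨x0, hx0I, hmin⟩ := isCompact_Icc.exists_isMinOn hne
    (fun x hx => (hF x (hx0 x hx)).1.continuousAt.continuousWithinAt)
  have hpos : ∀ x ∈ I, 0 < scalingMode n x := fun x hx => by
    have := hx1 x hx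
    have := hx0 x hx
    exact mul_pos (by linarith) (Real.rpow_pos_of_pos (by linarith) _)
  -- Subtracting ε from the zero mode leaves it positive and adds ε times the potential term, so the
  -- supersolution becomes strict; the 4 in δ comes from 1 + x ≤ 2.
  set ε := scalingMode n x0 / 2 with hε
  have hε0 : 0 < ε := half_pos (hpos x0 hx0I)
  refine exists_hasBarrier_of_normalized hn hκ le_rfl (δ := ε * (n * (n + 2)) / 4) (by positivity)
    (F := fun x => scalingMode n x - ε) (F1 := F1) (F2 := F2)
    (fun x hx => (hF x (hx0 x hx)).1.sub_const ε) (fun x hx => (hF x (hx0 x hx)).2.1) ?_ ?_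
  · intro x hx
    have : scalingMode n x0 ≤ scalingMode n x := hmin hx
    have := hpos x0 hx0I
    simp only [hε]
    linarith
  · intro x hx
    have h1 := (hF x (hx0 x hx)).2.2
    have h2 := hx0 x hx
    have h3 := hx1 x hx
    have h4 : normalizedOp n (fun x => scalingMode n x - ε) F1 F2 x =
        normalizedOp n (scalingMode n) F1 F2 x + ε * (n * (n + 2)) / (1 + x) ^ 2 := by
      simp only [normalizedOp]; ring
    rw [h4, h1, zero_add]
    refine div_le_div_of_nonneg_left (by positivity) (by positivity) ?_
    nlinarith

/-- The barrier on an annulus around the zero of the scaling mode. -/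
lemma exists_hasBarrier_middle {n : ℕ} (hn : 5 ≤ n) {κ b : ℝ}
    (hκ : κ = 1 / ((n : ℝ) * ((n : ℝ) - 2))) (hb : 1 ≤ b) :
    ∃ a, 0 < a ∧ a < 1 ∧ ∀ ra rb, 0 ≤ ra → κ * ra ^ 2 = a → κ * rb ^ 2 = b →
    ∃ l, 0 < l ∧ HasBarrier n (radialPotential n) l ra rb := by
  have hn' : (5 : ℝ) ≤ n := by exact_mod_cast hn
  obtain ⟨F1, F2, hF⟩ := exists_deriv_scalingMode n
  -- The barrier is -KZ + (2 - xⁿ). The operator annihilates -KZ, which serves only positivity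
  -- beyond x = 1; K is chosen so that -KZ ≥ (x-1) n b^(n-1) ≥ xⁿ - 1 on [1, b].
  set K : ℝ := n * b ^ (n - 1) * (1 + b) ^ ((n : ℝ) / 2) with hK
  have hKn : n ≤ K := by
    have h1 : (1 : ℝ) ≤ b ^ (n - 1) := one_le_pow₀ hb
    have h2 : (1 : ℝ) ≤ (1 + b) ^ ((n : ℝ) / 2) := Real.one_le_rpow (by linarith) (by positivity)
    rw [hK, mul_assoc]
    exact le_mul_of_one_le_right (by positivity) (one_le_mul_of_one_le_of_one_le h1 h2)
  have hK0 : 0 < K := by linarith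
  have hinv : 1 / (2 * K) ≤ 1 / (2 * n) := one_div_le_one_div_of_le (by positivity) (by linarith)
  have hinv' : 1 / (2 * (n : ℝ)) ≤ 1 / 10 := one_div_le_one_div_of_le (by norm_num) (by linarith)
  have hinv0 : 0 < 1 / (2 * K) := by positivity
  -- To the left of x = 1 the term -KZ is negative; this endpoint keeps KZ ≤ 1/2, while 2 - xⁿ ≥ 1.
  refine ⟨1 - 1 / (2 * K), by linarith, by linarith, fun ra rb hra ea eb => ?_⟩
  set I := Icc (κ * ra ^ 2) (κ * rb ^ 2) with hI
  have hxa : ∀ x ∈ I, 1 - 1 / (2 * K) ≤ x := fun x hx => ea ▸ hx.1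
  have hxb : ∀ x ∈ I, x ≤ b := fun x hx => eb ▸ hx.2
  have hx0 : ∀ x ∈ I, 9 / 10 ≤ x := fun x hx => by linarith [hxa x hx]
  refine exists_hasBarrier_of_normalized hn hκ hra (δ := 1) one_pos
    (F := fun x => -K * scalingMode n x + (2 - x ^ n))
    (F1 := fun x => -K * F1 x + -(n * x ^ (n - 1)))
    (F2 := fun x => -K * F2 x + -(n * ((n - 1 : ℕ) * x ^ (n - 1 - 1))))
    (fun x hx => ?_) (fun x hx => ?_) (fun x hx => ?_) fun x hx => ?_
  · have := hx0 x hx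
    exact ((hF x (by linarith)).1.const_mul _).add ((hasDerivAt_pow n x).const_sub 2)
  · have := hx0 x hx
    exact ((hF x (by linarith)).2.1.const_mul _).add
      (((hasDerivAt_pow (n - 1) x).const_mul (n : ℝ)).neg)
  · have h0 := hx0 x hx
    have hr0 : 0 < (1 + x) ^ (-(n : ℝ) / 2) := Real.rpow_pos_of_pos (by linarith) _
    rcases le_total x 1 with h1 | h1
    · have h2 : (1 + x) ^ (-(n : ℝ) / 2) ≤ 1 :=
        Real.rpow_le_one_of_one_le_of_nonpos (by linarith) (by
          rw [neg_div]; exact neg_nonpos.2 (by positivity))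
      have h3 : x ^ n ≤ 1 := pow_le_one₀ (by linarith) h1
      have h4 : K * scalingMode n x ≤ 1 / 2 := by
        calc K * scalingMode n x ≤ K * (1 / (2 * K) * 1) := by
              refine mul_le_mul_of_nonneg_left ?_ hK0.le
              exact mul_le_mul (by linarith [hxa x hx]) h2 hr0.le hinv0.le
          _ = 1 / 2 := by field_simp
      linarith
    · have h2 : x ^ n - 1 ≤ (x - 1) * (n * b ^ (n - 1)) := by
        rw [← mul_geom_sum x n]
        refine mul_le_mul_of_nonneg_left ?_ (by linarith)
        calc ∑ i ∈ Finset.range n, x ^ i ≤ ∑ i ∈ Finset.range n, b ^ (n - 1) := by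
              refine Finset.sum_le_sum fun i hi => ?_
              have : i ≤ n - 1 := by have := Finset.mem_range.1 hi; omega
              exact (pow_le_pow_right₀ h1 this).trans
                (pow_le_pow_left₀ (by linarith) (hxb x hx) _)
          _ = _ := by simp
      have h3 : (1 + b) ^ (-(n : ℝ) / 2) ≤ (1 + x) ^ (-(n : ℝ) / 2) :=
        Real.rpow_le_rpow_of_nonpos (by linarith) (by linarith [hxb x hx]) (by
          rw [neg_div]; exact neg_nonpos.2 (by positivity))
      have h4 : (1 + b) ^ ((n : ℝ) / 2) * (1 + b) ^ (-(n : ℝ) / 2) = 1 := by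
        rw [← Real.rpow_add (by linarith)]
        ring_nf
        exact Real.rpow_zero _
      have h5 : n * b ^ (n - 1) ≤ K * (1 + x) ^ (-(n : ℝ) / 2) := by
        calc (n : ℝ) * b ^ (n - 1) = K * (1 + b) ^ (-(n : ℝ) / 2) := by
              rw [hK, mul_assoc (n * b ^ (n - 1) : ℝ), h4, mul_one]
          _ ≤ _ := mul_le_mul_of_nonneg_left h3 hK0.le
      have h6 : (x - 1) * (n * b ^ (n - 1)) ≤ -K * scalingMode n x := by
        calc _ ≤ (x - 1) * (K * (1 + x) ^ (-(n : ℝ) / 2)) :=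
              mul_le_mul_of_nonneg_left h5 (by linarith)
          _ = _ := by rw [scalingMode]; ring
      linarith
  · have h0 := hx0 x hx
    have h1 := (hF x (by linarith)).2.2
    have hxp : x * x ^ (n - 1 - 1) = x ^ (n - 1) := by
      rw [← pow_succ']; congr 1; omega
    have hc : ((n - 1 : ℕ) : ℝ) = n - 1 := by
      rw [Nat.cast_sub (by omega)]; simp
    have h2 : normalizedOp n (fun x => -K * scalingMode n x + (2 - x ^ n))
        (fun x => -K * F1 x + -(n * x ^ (n - 1)))
        (fun x => -K * F2 x + -(n * ((n - 1 : ℕ) * x ^ (n - 1 - 1)))) x =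
        -K * normalizedOp n (scalingMode n) F1 F2 x + (4 * n * (n - 1) * x ^ (n - 1) +
          2 * n ^ 2 * x ^ (n - 1) - n * (n + 2) * (2 - x ^ n) / (1 + x) ^ 2) := by
      simp only [normalizedOp, hc]
      rw [← hxp]
      ring
    rw [h2, h1, mul_zero, zero_add]
    -- Bernoulli's inequality at x ≥ 1 - 1/(2n), which follows from K ≥ n.
    have h3 : 1 / 2 ≤ x ^ (n - 1) := by
      have hxn : 1 + -(1 / (2 * (n : ℝ))) ≤ x := by linarith [hxa x hx]
      have hbern := one_add_mul_le_pow (a := -(1 / (2 * (n : ℝ)))) (by linarith) (n - 1)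
      have hle := pow_le_pow_left₀ (by linarith) hxn (n - 1)
      have : ((n - 1 : ℕ) : ℝ) * -(1 / (2 * (n : ℝ))) = -(1 / 2) + 1 / (2 * n) := by
        rw [hc]; field_simp; ring
      have : 0 < 1 / (2 * (n : ℝ)) := by positivity
      linarith
    have h4 : n * (n + 2) * (2 - x ^ n) / (1 + x) ^ 2 ≤ n * (n + 2) * 2 / 3 := by
      refine div_le_div₀ (by positivity) ?_ (by norm_num) (by nlinarith)
      have : 0 ≤ x ^ n := by positivity
      exact mul_le_mul_of_nonneg_left (by linarith) (by positivity)
    have h5 : (4 * n * (n - 1) + 2 * n ^ 2 : ℝ) * (1 / 2) ≤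
        (4 * n * (n - 1) + 2 * n ^ 2) * x ^ (n - 1) :=
      mul_le_mul_of_nonneg_left h3 (by nlinarith)
    nlinarith

/-- The barrier on a large annulus far from the origin. -/
lemma hasBarrier_outer {n : ℕ} (hn : 5 ≤ n) {κ rb R : ℝ}
    (hκ : κ = 1 / ((n : ℝ) * ((n : ℝ) - 2))) (hrb : 0 < rb) (hR : rb ≤ R)
    (hb : κ * rb ^ 2 = 8 * n * (n + 2) / (n - 2) ^ 2) :
    HasBarrier n (radialPotential n) (1 / (8 * R ^ 2)) rb R := by
  have hn' : (5 : ℝ) ≤ n := by exact_mod_cast hn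
  have hκ0 : 0 < κ := by rw [hκ]; exact one_div_pos.2 (mul_sub_two_pos hn)
  have hn2 : 0 < (n : ℝ) - 2 := by linarith
  have hR0 : 0 < R := hrb.trans_le hR
  have hx0 : ∀ x ∈ Icc (κ * rb ^ 2) (κ * R ^ 2), 0 < x := fun x hx =>
    lt_of_lt_of_le (by positivity) hx.1
  -- Up to a constant, x^s = r^(-(n-2)/2), the optimal Hardy power, which yields (n-2)²/(4x). The
  -- starting value of x lets the potential consume at most half of this, and x ≤ κR² bounds the
  -- rest below.
  set s : ℝ := -((n : ℝ) - 2) / 4 with hs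
  refine hasBarrier_of_normalized hn hκ hrb.le (F := fun x => x ^ s)
    (F1 := fun x => s * x ^ (s - 1)) (F2 := fun x => s * ((s - 1) * x ^ (s - 1 - 1)))
    (fun x hx => Real.hasDerivAt_rpow_const (Or.inl (hx0 x hx).ne'))
    (fun x hx => (Real.hasDerivAt_rpow_const (Or.inl (hx0 x hx).ne')).const_mul s)
    (fun x hx => Real.rpow_pos_of_pos (hx0 x hx) s) fun x hx => ?_
  have h0 := hx0 x hx
  have e1 : x ^ (s - 1) = x ^ s / x := by rw [Real.rpow_sub h0, Real.rpow_one]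
  have e2 : x ^ (s - 1 - 1) = x ^ s / x ^ 2 := by
    rw [Real.rpow_sub h0, Real.rpow_one, e1]
    field_simp
  have e3 : normalizedOp n (fun x => x ^ s) (fun x => s * x ^ (s - 1))
      (fun x => s * ((s - 1) * x ^ (s - 1 - 1))) x =
      x ^ s * ((n - 2) ^ 2 / (4 * x) - n * (n + 2) / (1 + x) ^ 2) := by
    simp only [normalizedOp, e1, e2]
    generalize x ^ s = y
    rw [hs]
    field_simp
    ring
  have h1 : (n : ℝ) * (n + 2) / (1 + x) ^ 2 ≤ (n - 2) ^ 2 / (8 * x) := by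
    rw [div_le_div_iff₀ (by positivity) (by positivity)]
    have h2 := hx.1
    rw [hb, div_le_iff₀ (by positivity)] at h2
    have h3 : x ^ 2 ≤ (1 + x) ^ 2 := by nlinarith
    calc (n : ℝ) * (n + 2) * (8 * x) = 8 * n * (n + 2) * x := by ring
      _ ≤ x * (n - 2) ^ 2 * x := mul_le_mul_of_nonneg_right h2 h0.le
      _ = (n - 2) ^ 2 * x ^ 2 := by ring
      _ ≤ _ := mul_le_mul_of_nonneg_left h3 (by positivity)
  have h2 : 1 / (8 * R ^ 2) ≤ κ * ((n - 2) ^ 2 / (8 * x)) := by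
    rw [← mul_div_assoc, div_le_div_iff₀ (by positivity) (by positivity)]
    have h3 := hx.2
    have h4 : 1 ≤ ((n : ℝ) - 2) ^ 2 := one_le_pow₀ (by linarith)
    have h5 : κ * R ^ 2 * 1 ≤ κ * R ^ 2 * ((n : ℝ) - 2) ^ 2 :=
      mul_le_mul_of_nonneg_left h4 (by positivity)
    nlinarith
  have h3 : (n - 2) ^ 2 / (4 * x) = 2 * ((n - 2 : ℝ) ^ 2 / (8 * x)) := by
    field_simp; norm_num
  rw [e3, mul_comm (1 / (8 * R ^ 2)), mul_left_comm]
  refine mul_le_mul_of_nonneg_left (h2.trans ?_) (Real.rpow_nonneg h0.le s)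
  exact mul_le_mul_of_nonneg_left (by linarith) hκ0.le

/-! ### Assembling the barriers -/

/-- At most two eigenvalues are at most `c R ^ (-n / 2)`. -/
lemma exists_rank_spectralSpace_le_two {n : ℕ} (hn : 5 ≤ n) : ∃ c : ℝ, 0 < c ∧ ∀ R : ℝ, 1 < R →
    Module.rank ℝ (spectralSpace n R (c * R ^ (-(n : ℝ) / 2))) ≤ (2 : ℕ) := by
  have hn' : (5 : ℝ) ≤ n := by exact_mod_cast hn
  obtain ⟨κ, hκ⟩ : ∃ κ : ℝ, κ = 1 / ((n : ℝ) * ((n : ℝ) - 2)) := ⟨_, rfl⟩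
  have hκ0 : 0 < κ := by rw [hκ]; exact one_div_pos.2 (mul_sub_two_pos hn)
  have hrad : ∀ x, 0 < x → 0 < √(x / κ) ∧ κ * √(x / κ) ^ 2 = x := fun x hx => by
    refine ⟨Real.sqrt_pos.2 (by positivity), ?_⟩
    rw [Real.sq_sqrt (by positivity)]
    field_simp
  obtain ⟨b, hb⟩ : ∃ b : ℝ, b = 8 * n * (n + 2) / (n - 2) ^ 2 := ⟨_, rfl⟩
  have hb1 : 1 ≤ b := by
    rw [hb, one_le_div (by nlinarith)]
    nlinarith
  obtain ⟨a, ha0, ha1, hmid⟩ := exists_hasBarrier_middle hn hκ hb1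
  obtain ⟨ha, ea⟩ := hrad a ha0
  obtain ⟨hrb, eb⟩ := hrad b (by linarith)
  set ra := √(a / κ) with hra
  set rb := √(b / κ) with hrb'
  have hab : ra ≤ rb := Real.sqrt_le_sqrt (div_le_div_of_nonneg_right (by linarith) hκ0.le)
  obtain ⟨l2, hl2, B2⟩ := hmid ra rb ha.le ea eb
  obtain ⟨l1, hl1, B1⟩ := exists_hasBarrier_inner hn hκ (ra := ra) (by linarith)
  -- The final halving makes c R^(-n/2) strictly smaller than the barrier level l = 2c/R².
  set c := min (min l1 l2) (1 / 8) / 2 with hc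
  have hc0 : 0 < c := by positivity
  have hc1 : 2 * c ≤ l1 := by
    rw [hc]; linarith [(min_le_left (min l1 l2) (1 / 8)).trans (min_le_left l1 l2)]
  have hc2 : 2 * c ≤ l2 := by
    rw [hc]; linarith [(min_le_left (min l1 l2) (1 / 8)).trans (min_le_right l1 l2)]
  have hc3 : 2 * c ≤ 1 / 8 := by
    rw [hc]; linarith [min_le_right (min l1 l2) (1 / 8)]
  refine ⟨c, hc0, fun R hR => ?_⟩
  have hR0 : 0 < R := by linarith
  have hRi : 0 < 1 / R ^ 2 := by positivity
  have hRi1 : 1 / R ^ 2 ≤ 1 := by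
    rw [div_le_one (by positivity)]
    exact one_le_pow₀ hR.le
  set l := 2 * c * (1 / R ^ 2) with hl
  have hll : l ≤ 2 * c := mul_le_of_le_one_right (by positivity) hRi1
  have hpow : R ^ (-(n : ℝ) / 2) ≤ 1 / R ^ 2 := by
    calc R ^ (-(n : ℝ) / 2) ≤ R ^ (-((2 : ℕ) : ℝ)) :=
          Real.rpow_le_rpow_of_exponent_le hR.le (by push_cast; linarith)
      _ = 1 / R ^ 2 := by rw [Real.rpow_neg hR0.le, Real.rpow_natCast, one_div]
  refine rank_spectralSpace_le hn hR0 2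
    -- Cuts are truncated at R, so for small R some intervals collapse to points.
    (fun i => match i with | 0 => 0 | 1 => min ra R | 2 => min rb R | _ => R) rfl rfl
    (l := l) ?_ ?_ ?_
  · intro i hi
    interval_cases i
    · exact le_min ha.le hR0.le
    · exact min_le_min_right R hab
    · exact min_le_right _ _
  · intro i hi
    interval_cases i
    · exact B1.mono (hll.trans hc1) (min_le_left _ _)
    · change HasBarrier n (radialPotential n) l (min ra R) (min rb R)
      rcases le_total ra R with h | h
      · rw [min_eq_left h]
        exact B2.mono (hll.trans hc2) (min_le_left _ _)
      · rw [min_eq_right h, min_eq_right (h.trans hab)]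
        exact hasBarrier_self _ _ _ _
    · change HasBarrier n (radialPotential n) l (min rb R) R
      rcases le_total rb R with h | h
      · rw [min_eq_left h]
        refine (hasBarrier_outer hn hκ hrb h (by rw [eb, hb])).mono ?_ le_rfl
        calc l ≤ 1 / 8 * (1 / R ^ 2) := mul_le_mul_of_nonneg_right hc3 hRi.le
          _ = _ := by field_simp
      · rw [min_eq_right h]
        exact hasBarrier_self _ _ _ _
  · calc c * R ^ (-(n : ℝ) / 2) ≤ c * (1 / R ^ 2) := mul_le_mul_of_nonneg_left hpow hc0.le
      _ < l := by rw [hl]; nlinarith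

/-! ### Volterra equations -/

/-- A continuous function on a symmetric interval, extended by constants. -/
def extendIcc {L : ℝ} (hL : -L ≤ L) (f : C(Icc (-L) L, ℝ)) (t : ℝ) : ℝ := f (projIcc (-L) L hL t)

lemma continuous_extendIcc {L : ℝ} (hL : -L ≤ L) (f : C(Icc (-L) L, ℝ)) :
    Continuous (extendIcc hL f) := f.continuous.comp continuous_projIcc

lemma continuous_uncurry_extendIcc {L : ℝ} (hL : -L ≤ L) :
    Continuous fun p : C(Icc (-L) L, ℝ) × ℝ => extendIcc hL p.1 p.2 := by
  unfold extendIcc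
  exact continuous_fst.eval (continuous_projIcc.comp continuous_snd)

/-- The interval is symmetric about 0, so clamping preserves bounds of the form A|t|^k. -/
lemma abs_projIcc_le {L : ℝ} (hL : -L ≤ L) (t : ℝ) : |(projIcc (-L) L hL t : ℝ)| ≤ |t| := by
  rw [coe_projIcc]
  rcases le_total 0 t with h | h
  · rw [abs_of_nonneg h, abs_of_nonneg (le_max_of_le_right (le_min (by linarith) h))]
    exact max_le (by linarith) (min_le_right _ _)
  · rw [abs_of_nonpos h, min_eq_right (by linarith), abs_of_nonpos (max_le (by linarith) h)]
    linarith [le_max_right (-L) t]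

/-- The weighted mean `∫₀¹ τ ^ (n - 1) h(s τ²) dτ`. -/
def mean (n : ℕ) (h : ℝ → ℝ) (s : ℝ) : ℝ := ∫ τ in (0 : ℝ)..1, τ ^ (n - 1) * h (s * τ ^ 2)

lemma continuous_mean (n : ℕ) {h : ℝ → ℝ} (hh : Continuous h) : Continuous (mean n h) := by
  unfold mean
  fun_prop

lemma abs_mean_le (n : ℕ) {h : ℝ → ℝ} {A : ℝ} {k : ℕ} (hA : ∀ t, |h t| ≤ A * |t| ^ k) (s : ℝ) :
    |mean n h s| ≤ A * |s| ^ k := by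
  have hA0 : ∀ t, 0 ≤ A * |t| ^ k := fun t => (abs_nonneg _).trans (hA t)
  have hA' : 0 ≤ A := by simpa using hA0 1
  have := intervalIntegral.norm_integral_le_of_norm_le_const (a := (0 : ℝ)) (b := 1)
    (f := fun τ => τ ^ (n - 1) * h (s * τ ^ 2)) (C := A * |s| ^ k) fun τ hτ => by
      rw [uIoc_of_le zero_le_one] at hτ
      have h1 : |τ| ≤ 1 := by rw [abs_of_pos hτ.1]; exact hτ.2
      have h2 : |τ ^ (n - 1)| ≤ 1 := by rw [abs_pow]; exact pow_le_one₀ (abs_nonneg _) h1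
      have h3 : |s * τ ^ 2| ≤ |s| := by
        rw [abs_mul, abs_pow]
        exact mul_le_of_le_one_right (abs_nonneg _) (pow_le_one₀ (abs_nonneg _) h1)
      rw [Real.norm_eq_abs, abs_mul]
      calc |τ ^ (n - 1)| * |h (s * τ ^ 2)| ≤ 1 * (A * |s| ^ k) := by
            refine mul_le_mul h2 ((hA _).trans ?_) (abs_nonneg _) zero_le_one
            exact mul_le_mul_of_nonneg_left (pow_le_pow_left₀ (abs_nonneg _) h3 k) hA'
        _ = _ := one_mul _
  simpa [mean] using this

lemma abs_integral_le_of_abs_le_pow {g : ℝ → ℝ} (hg : Continuous g) {A : ℝ} {k : ℕ}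
    (hA : ∀ s, |g s| ≤ A * |s| ^ k) (t : ℝ) :
    |∫ s in (0 : ℝ)..t, g s| ≤ A * (|t| ^ (k + 1) / (k + 1)) := by
  have h1 := intervalIntegral.norm_integral_le_integral_norm_uIoc (f := g) (a := 0) (b := t)
    (μ := MeasureTheory.volume)
  refine h1.trans ?_
  have h2 : ∫ s in Set.uIoc 0 t, |s| ^ k = |t| ^ (k + 1) / (k + 1) := by
    simpa using integral_pow_abs_sub_uIoc (a := 0) (b := t) (n := k)
  rw [← h2, ← MeasureTheory.integral_const_mul]
  refine MeasureTheory.setIntegral_mono ?_ ?_ fun s => hA s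
  · exact (intervalIntegrable_iff.1 (hg.norm.intervalIntegrable 0 t))
  · exact (intervalIntegrable_iff.1
      ((by fun_prop : Continuous fun s => A * |s| ^ k).intervalIntegrable 0 t))

/-- The Volterra operator inverting the radial Laplacian in the variable `t = |y|²`. -/
def volterraFun (n : ℕ) {L : ℝ} (hL : -L ≤ L) (f : C(Icc (-L) L, ℝ)) (t : ℝ) : ℝ :=
  ∫ s in (0 : ℝ)..t, mean n (extendIcc hL f) s

/-- Averaging preserves a bound A|t|^k and integration gains |t|/(k+1); iterating produces the
factorial. -/
lemma volterraFun_bound (n : ℕ) {L : ℝ} (hL : -L ≤ L) (f : C(Icc (-L) L, ℝ)) {A : ℝ} {k : ℕ}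
    (hA0 : 0 ≤ A) (hA : ∀ t, |f t| ≤ A * |(t : ℝ)| ^ k) (t : ℝ) :
    |volterraFun n hL f t| ≤ A * (|t| ^ (k + 1) / (k + 1)) := by
  have hA' : ∀ t, |extendIcc hL f t| ≤ A * |t| ^ k := fun t =>
    (hA _).trans (mul_le_mul_of_nonneg_left
      (pow_le_pow_left₀ (abs_nonneg _) (abs_projIcc_le hL t) k) hA0)
  exact abs_integral_le_of_abs_le_pow (continuous_mean n (continuous_extendIcc hL f))
    (fun s => abs_mean_le n hA' s) t

lemma continuous_volterraFun (n : ℕ) {L : ℝ} (hL : -L ≤ L) (f : C(Icc (-L) L, ℝ)) :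
    Continuous (volterraFun n hL f) :=
  continuous_primitive (fun a b =>
    (continuous_mean n (continuous_extendIcc hL f)).intervalIntegrable a b) 0

/-- `volterraFun` as a bounded operator, with the factor `1 / 2`. -/
def volterra (n : ℕ) {L : ℝ} (hL : -L ≤ L) : C(Icc (-L) L, ℝ) →L[ℝ] C(Icc (-L) L, ℝ) :=
  LinearMap.mkContinuous
    { toFun := fun f => ⟨fun t => 1 / 2 * volterraFun n hL f t,
        continuous_const.mul ((continuous_volterraFun n hL f).comp continuous_subtype_val)⟩
      map_add' := fun f g => by
        have hf := continuous_extendIcc hL f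
        have hg := continuous_extendIcc hL g
        have h1 : mean n (extendIcc hL (f + g)) =
            fun s => mean n (extendIcc hL f) s + mean n (extendIcc hL g) s := by
          ext s
          unfold mean
          rw [← intervalIntegral.integral_add ((by fun_prop : Continuous _).intervalIntegrable _ _)
            ((by fun_prop : Continuous _).intervalIntegrable _ _)]
          refine intervalIntegral.integral_congr fun τ _ => ?_
          simp only [extendIcc, ContinuousMap.add_apply]
          ring
        ext t
        simp only [volterraFun, h1, ContinuousMap.coe_mk, ContinuousMap.add_apply]
        rw [intervalIntegral.integral_add ((continuous_mean n hf).intervalIntegrable _ _)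
          ((continuous_mean n hg).intervalIntegrable _ _)]
        ring
      map_smul' := fun c f => by
        have h1 : mean n (extendIcc hL (c • f)) = fun s => c * mean n (extendIcc hL f) s := by
          ext s
          unfold mean
          rw [← intervalIntegral.integral_const_mul]
          refine intervalIntegral.integral_congr fun τ _ => ?_
          simp only [extendIcc, ContinuousMap.smul_apply, smul_eq_mul]
          ring
        ext t
        simp only [volterraFun, h1, ContinuousMap.coe_mk, ContinuousMap.smul_apply, smul_eq_mul,
          RingHom.id_apply, intervalIntegral.integral_const_mul]
        ring } L (fun f => by
    have hL0 : 0 ≤ L := by linarith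
    rw [ContinuousMap.norm_le _ (by positivity)]
    intro t
    have h1 := volterraFun_bound n hL f (A := ‖f‖) (k := 0) (norm_nonneg f)
      (fun t => by simpa using f.norm_coe_le_norm t) t
    have h2 : |(t : ℝ)| ≤ L := abs_le.2 t.2
    simp only [LinearMap.coe_mk, AddHom.coe_mk, ContinuousMap.coe_mk, Real.norm_eq_abs, abs_mul]
    have h3 : ‖f‖ * |(t : ℝ)| ≤ ‖f‖ * L := mul_le_mul_of_nonneg_left h2 (norm_nonneg f)
    simp only [zero_add, pow_one, CharP.cast_eq_zero, div_one] at h1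
    rw [abs_of_pos (by norm_num : (0 : ℝ) < 1 / 2)]
    nlinarith [abs_nonneg (volterraFun n hL f t)])

/-- `volterra` composed with multiplication. -/
def volterraMul (n : ℕ) {L : ℝ} (hL : -L ≤ L) (v : C(Icc (-L) L, ℝ)) :
    C(Icc (-L) L, ℝ) →L[ℝ] C(Icc (-L) L, ℝ) :=
  (volterra n hL).comp (ContinuousLinearMap.mul ℝ _ v)

lemma abs_volterraMul_iterate_le (n : ℕ) {L : ℝ} (hL : -L ≤ L) (v f : C(Icc (-L) L, ℝ)) (k : ℕ)
    (t : Icc (-L) L) :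
    |(volterraMul n hL v)^[k] f t| ≤ ‖v‖ ^ k / k.factorial * ‖f‖ * |(t : ℝ)| ^ k := by
  induction k generalizing t with
  | zero => simpa using f.norm_coe_le_norm t
  | succ k ih =>
    have h0 : (volterraMul n hL v)^[k + 1] f t =
        1 / 2 * volterraFun n hL (v * (volterraMul n hL v)^[k] f) t := by
      rw [Function.iterate_succ_apply']
      rfl
    rw [h0, abs_mul, abs_of_pos (by norm_num : (0 : ℝ) < 1 / 2)]
    have h1 := volterraFun_bound n hL (v * (volterraMul n hL v)^[k] f)
      (A := ‖v‖ * (‖v‖ ^ k / k.factorial * ‖f‖)) (k := k) (by positivity) (fun t => by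
        rw [ContinuousMap.mul_apply, abs_mul, mul_assoc]
        exact mul_le_mul (v.norm_coe_le_norm t) (ih t) (abs_nonneg _) (norm_nonneg _)) t
    refine (mul_le_of_le_one_left (abs_nonneg _) (by norm_num)).trans (h1.trans_eq ?_)
    rw [Nat.factorial_succ]
    push_cast
    field_simp
    ring

lemma norm_volterraMul_iterate_le (n : ℕ) {L : ℝ} (hL : -L ≤ L) (v f : C(Icc (-L) L, ℝ)) (k : ℕ) :
    ‖(volterraMul n hL v)^[k] f‖ ≤ (‖v‖ * L) ^ k / k.factorial * ‖f‖ := by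
  have hL0 : 0 ≤ L := by linarith
  rw [ContinuousMap.norm_le _ (by positivity)]
  intro t
  have h2 : |(t : ℝ)| ≤ L := abs_le.2 t.2
  refine (abs_volterraMul_iterate_le n hL v f k t).trans ?_
  calc _ ≤ ‖v‖ ^ k / k.factorial * ‖f‖ * L ^ k := by gcongr
    _ = _ := by rw [mul_pow]; ring

/-- 1 - (-T)^k is a unit by the Neumann series and factors as 1 + T times a commuting geometric sum.
-/
lemma isUnit_one_add_of_norm_pow_lt {A : Type*} [NormedRing A] [CompleteSpace A] {T : A} {k : ℕ}
    (hk : ‖T ^ k‖ < 1) : IsUnit (1 + T) := by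
  have hx : ‖(-T) ^ k‖ < 1 := by
    rcases Nat.even_or_odd k with he | ho
    · rwa [he.neg_pow]
    · rwa [ho.neg_pow, norm_neg]
  have hu : IsUnit (1 - (-T) ^ k) := (Units.oneSub _ hx).isUnit
  have hcomm : Commute (1 - -T) (∑ i ∈ Finset.range k, (-T) ^ i) :=
    (Commute.one_left _).sub_left (Commute.sum_right _ _ _ fun i _ => Commute.self_pow _ _)
  rw [← mul_neg_geom_sum, hcomm.isUnit_mul_iff] at hu
  simpa using hu.1

/-- Equations of Volterra type are solvable, continuously in a parameter. -/
lemma exists_continuous_solution {E : Type*} [NormedAddCommGroup E] [NormedSpace ℝ E]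
    [CompleteSpace E] (T : ℝ → E →L[ℝ] E) (cT : Continuous T) (c : ℝ → ℝ) (hc : ∀ μ, 0 ≤ c μ)
    (hT : ∀ μ k f, ‖(T μ)^[k] f‖ ≤ c μ ^ k / k.factorial * ‖f‖) (e : E) :
    ∃ u : ℝ → E, Continuous u ∧ ∀ μ, u μ + T μ (u μ) = e := by
  have hpow : ∀ μ k f, (T μ ^ k) f = (T μ)^[k] f := fun μ k f => by
    induction k with
    | zero => rfl
    | succ k ih => rw [pow_succ', Function.iterate_succ_apply', ← ih]; rfl
  have hunit : ∀ μ, IsUnit (1 + T μ) := fun μ => by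
    -- Since c^k / k! tends to 0, some power of T has norm below 1 however large T is.
    obtain ⟨k, hk⟩ := ((FloorSemiring.tendsto_pow_div_factorial_atTop (c μ)).eventually
      (gt_mem_nhds one_pos)).exists
    refine isUnit_one_add_of_norm_pow_lt (k := k) (lt_of_le_of_lt ?_ hk)
    have := hc μ
    exact ContinuousLinearMap.opNorm_le_bound _ (by positivity) fun f => by
      rw [hpow]; exact hT μ k f
  have cS : Continuous fun μ => Ring.inverse (1 + T μ) := by
    rw [continuous_iff_continuousAt]
    intro μ
    obtain ⟨w, hw⟩ := hunit μ
    have h1 : ContinuousAt Ring.inverse (1 + T μ) := hw ▸ NormedRing.inverse_continuousAt w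
    exact ContinuousAt.comp (f := fun μ => 1 + T μ) h1 (by fun_prop)
  refine ⟨fun μ => Ring.inverse (1 + T μ) e, cS.clm_apply continuous_const, fun μ => ?_⟩
  have h1 := Ring.mul_inverse_cancel _ (hunit μ)
  have h2 := congrArg (fun A : E →L[ℝ] E => A e) h1
  simpa using h2

/-- Differentiation of `mean`, and the Euler identity. -/
lemma hasDerivAt_mean {n : ℕ} (hn : 5 ≤ n) {h h' : ℝ → ℝ} (hc : Continuous h)
    (hc' : Continuous h') {a b : ℝ} (ha : a < 0) (hb : 0 < b)
    (hd : ∀ t ∈ Ioo a b, HasDerivAt h (h' t) t) {s : ℝ} (hs : s ∈ Ioo a b) :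
    HasDerivAt (mean n h) (mean (n + 2) h' s) s ∧
      2 * s * mean (n + 2) h' s + n * mean n h s = h s := by
  have hmem : ∀ s ∈ Ioo a b, ∀ τ ∈ Icc (0 : ℝ) 1, s * τ ^ 2 ∈ Ioo a b := by
    intro s hs τ hτ
    have h1 : τ ^ 2 ≤ 1 := pow_le_one₀ hτ.1 hτ.2
    have h0 : 0 ≤ τ ^ 2 := by positivity
    rcases le_total 0 s with h | h
    · exact ⟨by nlinarith, by nlinarith [hs.2]⟩
    · exact ⟨by nlinarith [hs.1], by nlinarith⟩
  have hpow : ∀ τ : ℝ, τ ^ (n + 2 - 1) = τ ^ (n - 1) * τ ^ 2 := fun τ => by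
    rw [← pow_add]; congr 1; omega
  have hdτ : ∀ s ∈ Ioo a b, ∀ τ ∈ Icc (0 : ℝ) 1, HasDerivAt (fun s => τ ^ (n - 1) * h (s * τ ^ 2))
      (τ ^ (n + 2 - 1) * h' (s * τ ^ 2)) s := by
    intro s hs τ hτ
    have h1 := HasDerivAt.comp (h := fun s : ℝ => s * τ ^ 2) s (hd _ (hmem s hs τ hτ))
      ((hasDerivAt_id s).mul_const (τ ^ 2))
    refine (h1.const_mul (τ ^ (n - 1))).congr_deriv ?_
    rw [hpow]; ring
  obtain ⟨C, hC⟩ := isCompact_Icc.exists_bound_of_continuousOn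
    (hc'.continuousOn (s := Icc a b))
  constructor
  · refine (intervalIntegral.hasDerivAt_integral_of_dominated_loc_of_deriv_le
      (μ := MeasureTheory.volume) (a := 0) (b := 1)
      (F := fun s τ => τ ^ (n - 1) * h (s * τ ^ 2))
      (F' := fun s τ => τ ^ (n + 2 - 1) * h' (s * τ ^ 2)) (bound := fun _ => C)
      (isOpen_Ioo.mem_nhds hs) ?_ ?_ ?_ ?_ ?_ ?_).2
    · exact Eventually.of_forall fun s => (by fun_prop : Continuous _).aestronglyMeasurable
    · exact (by fun_prop : Continuous _).intervalIntegrable _ _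
    · exact (by fun_prop : Continuous _).aestronglyMeasurable
    · refine Eventually.of_forall fun τ hτ s hs => ?_
      rw [uIoc_of_le zero_le_one] at hτ
      have h1 := hC _ (Ioo_subset_Icc_self (hmem s hs τ ⟨hτ.1.le, hτ.2⟩))
      rw [norm_mul, norm_pow, Real.norm_of_nonneg hτ.1.le]
      exact (mul_le_of_le_one_left (norm_nonneg _) (pow_le_one₀ hτ.1.le hτ.2)).trans h1
    · exact intervalIntegrable_const
    · refine Eventually.of_forall fun τ hτ s hs => ?_
      rw [uIoc_of_le zero_le_one] at hτ
      exact hdτ s hs τ ⟨hτ.1.le, hτ.2⟩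
  · have h1 : ∀ τ ∈ uIcc (0 : ℝ) 1, HasDerivAt (fun τ => τ ^ n * h (s * τ ^ 2))
        (2 * s * (τ ^ (n + 2 - 1) * h' (s * τ ^ 2)) + n * (τ ^ (n - 1) * h (s * τ ^ 2))) τ := by
      intro τ hτ
      rw [uIcc_of_le zero_le_one] at hτ
      have h2 := HasDerivAt.comp (h := fun τ : ℝ => s * τ ^ 2) τ (hd _ (hmem s hs τ hτ))
        ((hasDerivAt_pow 2 τ).const_mul s)
      refine ((hasDerivAt_pow n τ).mul h2).congr_deriv ?_
      rw [hpow, show τ ^ n = τ ^ (n - 1) * τ by rw [← pow_succ]; congr 1; omega]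
      simp only [Function.comp]
      push_cast
      ring
    have h3 := intervalIntegral.integral_eq_sub_of_hasDerivAt h1
      ((by fun_prop : Continuous _).intervalIntegrable _ _)
    rw [intervalIntegral.integral_add ((by fun_prop : Continuous _).intervalIntegrable _ _)
      ((by fun_prop : Continuous _).intervalIntegrable _ _), intervalIntegral.integral_const_mul,
      intervalIntegral.integral_const_mul] at h3
    simpa [mean, show n ≠ 0 by omega] using h3

/-- The potential as a function of `t = |y|²`, extended to negative `t`. -/
def potentialSq (n : ℕ) (t : ℝ) : ℝ :=
  critExp n / (1 + 1 / ((n : ℝ) * ((n : ℝ) - 2)) * max t (-1)) ^ 2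

lemma potentialSq_sq (n : ℕ) (r : ℝ) : potentialSq n (r ^ 2) = radialPotential n r := by
  rw [potentialSq, radialPotential, max_eq_left (by nlinarith [sq_nonneg r])]

/-- As n(n-2) > 1, clamping t at -1 keeps the denominator positive. Extending past 0 makes the
origin an interior point, where two-sided derivatives make sense. -/
lemma potentialSq_denom_pos {n : ℕ} (hn : 5 ≤ n) (t : ℝ) :
    0 < 1 + 1 / ((n : ℝ) * ((n : ℝ) - 2)) * max t (-1) := by
  have hn' : (5 : ℝ) ≤ n := by exact_mod_cast hn
  have h1 : 1 < (n : ℝ) * ((n : ℝ) - 2) := by nlinarith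
  have h2 : 1 / ((n : ℝ) * ((n : ℝ) - 2)) < 1 := (div_lt_one (by linarith)).2 h1
  have h3 : 0 < 1 / ((n : ℝ) * ((n : ℝ) - 2)) := by positivity
  nlinarith [le_max_right t (-1)]

lemma continuous_potentialSq {n : ℕ} (hn : 5 ≤ n) : Continuous (potentialSq n) :=
  Continuous.div (by fun_prop) (by fun_prop) fun t => (pow_pos (potentialSq_denom_pos hn t) 2).ne'

/-- The derivative of `potentialSq`. -/
lemma exists_deriv_potentialSq {n : ℕ} (hn : 5 ≤ n) : ∃ V' : ℝ → ℝ, Continuous V' ∧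
    ∀ t, -1 < t → HasDerivAt (potentialSq n) (V' t) t := by
  set κ := 1 / ((n : ℝ) * ((n : ℝ) - 2)) with hκ
  refine ⟨fun t => -(2 * κ * critExp n) / (1 + κ * max t (-1)) ^ 3,
    Continuous.div (by fun_prop) (by fun_prop)
      fun t => (pow_pos (potentialSq_denom_pos hn t) 3).ne', fun t ht => ?_⟩
  have h0 : 1 + κ * t ≠ 0 := by
    have := potentialSq_denom_pos hn t
    rw [max_eq_left ht.le] at this
    exact this.ne'
  have h1 : HasDerivAt (fun t => critExp n / (1 + κ * t) ^ 2)
      (-(2 * κ * critExp n) / (1 + κ * max t (-1)) ^ 3) t := by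
    have h2 := (((hasDerivAt_id t).const_mul κ).const_add 1).pow 2
    have h3 := (hasDerivAt_const t (critExp n)).div h2 (pow_ne_zero 2 h0)
    refine h3.congr_deriv ?_
    rw [max_eq_left ht.le]
    simp only [id, Pi.pow_apply]
    field_simp
    ring
  refine h1.congr_of_eventuallyEq ?_
  filter_upwards [isOpen_Ioi.mem_nhds ht] with x hx
  rw [potentialSq, ← hκ, max_eq_left (le_of_lt hx)]

lemma volterraMul_apply (n : ℕ) {L : ℝ} (hL : -L ≤ L) (v f : C(Icc (-L) L, ℝ))
    (t : Icc (-L) L) : volterraMul n hL v f t = 1 / 2 * volterraFun n hL (v * f) t := rfl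

lemma continuous_volterraMul (n : ℕ) {L : ℝ} (hL : -L ≤ L) : Continuous (volterraMul n hL) :=
  continuous_const.clm_comp (ContinuousLinearMap.mul ℝ _).continuous

lemma exists_volterra_solution (n : ℕ) {L : ℝ} (hL : -L ≤ L) (v : C(Icc (-L) L, ℝ)) :
    ∃ u : ℝ → C(Icc (-L) L, ℝ), Continuous u ∧ ∀ μ t,
      u μ t + 1 / 2 * volterraFun n hL ((v + ContinuousMap.const _ μ) * u μ) t = 1 := by
  have hL0 : 0 ≤ L := by linarith
  obtain ⟨u, cu, heq⟩ := exists_continuous_solution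
    (fun μ => volterraMul n hL (v + ContinuousMap.const _ μ))
    ((continuous_volterraMul n hL).comp (continuous_const.add ContinuousMap.continuous_const'))
    (fun μ => ‖v + ContinuousMap.const _ μ‖ * L) (fun μ => mul_nonneg (norm_nonneg _) hL0)
    (fun μ k f => norm_volterraMul_iterate_le n hL _ f k) 1
  refine ⟨u, cu, fun μ t => ?_⟩
  rw [← volterraMul_apply]
  exact congrArg (fun f : C(Icc (-L) L, ℝ) => f t) (heq μ)

/-! ### Regular solutions of the radial equation -/

/-- The regular solutions of the radial equation in the variable `t = |y|²`. -/
theorem exists_regular_solution {n : ℕ} (hn : 5 ≤ n) {L : ℝ} (hL : 1 ≤ L) :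
    ∃ U m : ℝ → ℝ → ℝ, Continuous (Function.uncurry U) ∧ Continuous (Function.uncurry m) ∧
      ∀ μ, U μ 0 = 1 ∧ ∃ m' : ℝ → ℝ, Continuous m' ∧ ∀ t ∈ Ioo (-1) L,
        HasDerivAt (U μ) (-m μ t / 2) t ∧ HasDerivAt (m μ) (m' t) t ∧
          2 * t * m' t + n * m μ t = (potentialSq n t + μ) * U μ t := by
  have hLL : -L ≤ L := by linarith
  have cV := continuous_potentialSq hn
  obtain ⟨V', cV', hV'⟩ := exists_deriv_potentialSq hn
  set v : C(Icc (-L) L, ℝ) := ⟨fun t => potentialSq n t, cV.comp continuous_subtype_val⟩ with hv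
  obtain ⟨u, cu, heq⟩ := exists_volterra_solution n hLL v
  obtain ⟨U, hU⟩ : ∃ U : ℝ → ℝ → ℝ, U = fun μ t => extendIcc hLL (u μ) t := ⟨_, rfl⟩
  obtain ⟨h, hh⟩ : ∃ h : ℝ → ℝ → ℝ,
      h = fun μ t => (potentialSq n (projIcc (-L) L hLL t) + μ) * U μ t := ⟨_, rfl⟩
  have cU : Continuous (Function.uncurry U) := by
    rw [hU]
    exact (continuous_uncurry_extendIcc hLL).comp ((cu.comp continuous_fst).prodMk continuous_snd)
  have ch : Continuous (Function.uncurry h) := by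
    have h1 : Continuous fun p : ℝ × ℝ => U p.1 p.2 := cU
    have h2 : Continuous fun p : ℝ × ℝ => (potentialSq n (projIcc (-L) L hLL p.2) + p.1) :=
      (cV.comp (continuous_subtype_val.comp (continuous_projIcc.comp continuous_snd))).add
        continuous_fst
    rw [hh]
    exact h2.mul h1
  have ch' : ∀ μ, Continuous (h μ) := fun μ => ch.comp (Continuous.prodMk_right μ)
  have cU' : ∀ μ, Continuous (U μ) := fun μ => cU.comp (Continuous.prodMk_right μ)
  have hproj : ∀ t ∈ Ioo (-1) L, (projIcc (-L) L hLL t : ℝ) = t := fun t ht => by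
    rw [projIcc_of_mem hLL ⟨by linarith [ht.1], ht.2.le⟩]
  have hhU : ∀ μ, ∀ t ∈ Ioo (-1) L, h μ t = (potentialSq n t + μ) * U μ t := fun μ t ht => by
    simp only [hh, hproj t ht]
  have hfix : ∀ μ, ∀ t ∈ Ioo (-1) L, U μ t = 1 - 1 / 2 * ∫ s in (0 : ℝ)..t, mean n (h μ) s := by
    intro μ t ht
    have h1 := heq μ (projIcc (-L) L hLL t)
    have h2 : extendIcc hLL ((v + ContinuousMap.const _ μ) * u μ) = h μ := by rw [hh, hU]; rfl
    rw [volterraFun, h2, hproj t ht] at h1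
    simp only [hU, extendIcc]
    linarith
  have hU' : ∀ μ, ∀ t ∈ Ioo (-1) L, HasDerivAt (U μ) (-mean n (h μ) t / 2) t := by
    intro μ t ht
    have h1 := ((((continuous_mean n (ch' μ)).integral_hasStrictDerivAt 0 t).hasDerivAt).const_mul
      (1 / 2)).const_sub 1
    refine (h1.congr_of_eventuallyEq ?_).congr_deriv (by ring)
    filter_upwards [isOpen_Ioo.mem_nhds ht] with x hx using hfix μ x hx
  refine ⟨U, fun μ => mean n (h μ), cU, ?_, fun μ => ⟨?_, ?_⟩⟩
  · unfold mean
    simp only [Function.uncurry_def] at ch ⊢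
    refine intervalIntegral.continuous_parametric_intervalIntegral_of_continuous' ?_ 0 1
    have : Continuous fun q : (ℝ × ℝ) × ℝ => h q.1.1 (q.1.2 * q.2 ^ 2) :=
      ch.comp (by fun_prop : Continuous fun q : (ℝ × ℝ) × ℝ => (q.1.1, q.1.2 * q.2 ^ 2))
    exact (by fun_prop : Continuous fun q : (ℝ × ℝ) × ℝ => q.2 ^ (n - 1)).mul this
  · rw [hfix μ 0 ⟨by norm_num, by linarith⟩]
    simp
  -- Bootstrap: the integral equation makes U differentiable, hence h = (V + μ)U, hence its mean.
  · set h' : ℝ → ℝ := fun t => V' t * U μ t + (potentialSq n t + μ) * (-mean n (h μ) t / 2)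
    have cm := continuous_mean n (ch' μ)
    have cUμ := cU' μ
    have ch'' : Continuous h' := by fun_prop
    have hd : ∀ t ∈ Ioo (-1) L, HasDerivAt (h μ) (h' t) t := by
      intro t ht
      have h1 := ((hV' t ht.1).add_const μ).mul (hU' μ t ht)
      refine h1.congr_of_eventuallyEq ?_
      filter_upwards [isOpen_Ioo.mem_nhds ht] with x hx using hhU μ x hx
    refine ⟨mean (n + 2) h', continuous_mean _ ch'', fun t ht => ?_⟩
    have h1 := hasDerivAt_mean hn (ch' μ) ch'' (by norm_num) (by linarith) hd ht
    exact ⟨hU' μ t ht, h1.1, h1.2.trans (hhU μ t ht)⟩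

/-! ### The Prüfer angle -/

/-- The derivative of the Prüfer angle, defined by `s u = ρ cos θ`, `u' = -r q = ρ sin θ`. -/
def pruferRate (N : ℕ) (s V u q r : ℝ) : ℝ :=
  -s - s * u * (V * u - N * q) / (s ^ 2 * u ^ 2 + (r * q) ^ 2)

/-- A regular solution on `[0, R]` of `u'' + N u' / r + (V + s²) u = 0` with `u(0) = 1`;
`q` is `-u' / r`. -/
structure RegularSolution (N : ℕ) (R s p : ℝ) (V u q : ℝ → ℝ) : Prop where
  one_le : 1 ≤ s
  cont_V : Continuous V
  cont_u : Continuous u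
  cont_q : Continuous q
  V_nonneg : ∀ r, 0 ≤ V r
  V_le : ∀ r, V r ≤ p
  init : u 0 = 1
  deriv_u : ∀ r ∈ Icc 0 R, HasDerivAt u (-(r * q r)) r
  deriv_q : ∀ r ∈ Icc 0 R, HasDerivAt (fun r => r * q r) ((V r + s ^ 2) * u r - N * q r) r

namespace RegularSolution

variable {N : ℕ} {R s p : ℝ} {V u q : ℝ → ℝ}

/-- A regular solution and its derivative do not vanish simultaneously. -/
lemma pos (H : RegularSolution N R s p V u q) {r : ℝ} (hr : r ∈ Icc 0 R) :
    0 < s ^ 2 * u r ^ 2 + (r * q r) ^ 2 := by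
  have hs := H.one_le
  have cu := H.cont_u
  have cq := H.cont_q
  have hnn : ∀ r, 0 ≤ s ^ 2 * u r ^ 2 + (r * q r) ^ 2 := fun r => by positivity
  -- The weight r^(2N) absorbs the friction term and exp(pr) the potential, so D is nondecreasing. A
  -- zero at r > 0 would force u = 0 on (0, r), against u(0) = 1.
  set D : ℝ → ℝ := fun r => Real.exp (p * r) * (r ^ (2 * N) * (s ^ 2 * u r ^ 2 + (r * q r) ^ 2))
    with hD
  have hmono : MonotoneOn D (Icc 0 R) := by
    refine monotoneOn_of_hasDerivWithinAt_nonneg (convex_Icc 0 R) (by fun_prop)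
      (f' := fun r => Real.exp (p * r) * (r ^ (2 * N) * (p * (s ^ 2 * u r ^ 2 + (r * q r) ^ 2) +
        V r * (2 * u r * (r * q r))) + (2 * N : ℕ) * r ^ (2 * N - 1) * (s ^ 2 * u r ^ 2))) ?_ ?_
    · intro r hr
      have hr' := interior_subset hr
      rw [interior_Icc] at hr
      have d1 := H.deriv_u r hr'
      have d2 := H.deriv_q r hr'
      have d3 := ((hasDerivAt_id r).const_mul p).exp.mul ((hasDerivAt_pow (2 * N) r).mul
        (((d1.pow 2).const_mul (s ^ 2)).add (d2.pow 2)))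
      refine (d3.congr_deriv ?_).hasDerivWithinAt
      simp only [id, Pi.add_apply, Pi.mul_apply, Pi.pow_apply]
      rcases Nat.eq_zero_or_pos N with h | h
      · subst h
        simp
        ring
      · have : r ^ (2 * N) = r ^ (2 * N - 1) * r := by rw [← pow_succ]; congr 1; omega
        rw [this]
        push_cast
        ring
    · intro r hr
      rw [interior_Icc] at hr
      have hr0 := hr.1.le
      have h1 : -(u r ^ 2 + (r * q r) ^ 2) ≤ 2 * u r * (r * q r) := by
        nlinarith [sq_nonneg (u r + r * q r)]
      have h2 : u r ^ 2 ≤ s ^ 2 * u r ^ 2 :=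
        le_mul_of_one_le_left (sq_nonneg _) (one_le_pow₀ hs)
      have h3 : 0 ≤ p * (s ^ 2 * u r ^ 2 + (r * q r) ^ 2) + V r * (2 * u r * (r * q r)) := by
        have h4 := mul_le_mul_of_nonneg_right (H.V_le r) (hnn r)
        have h5 : V r * (-(s ^ 2 * u r ^ 2 + (r * q r) ^ 2)) ≤ V r * (2 * u r * (r * q r)) :=
          mul_le_mul_of_nonneg_left (by linarith) (H.V_nonneg r)
        linarith
      positivity
  rcases hr.1.eq_or_lt with h0 | h0
  · subst h0
    rw [H.init]
    positivity
  by_contra hcon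
  have hz : s ^ 2 * u r ^ 2 + (r * q r) ^ 2 = 0 := le_antisymm (not_lt.1 hcon) (hnn r)
  have hu0 : ∀ x ∈ Ioo 0 r, u x = 0 := by
    intro x hx
    have h1 := hmono ⟨hx.1.le, hx.2.le.trans hr.2⟩ hr hx.2.le
    simp only [hD, hz, mul_zero] at h1
    have h2 : 0 < Real.exp (p * x) * x ^ (2 * N) := mul_pos (Real.exp_pos _) (pow_pos hx.1 _)
    rw [← mul_assoc] at h1
    have h3 : s ^ 2 * u x ^ 2 + (x * q x) ^ 2 ≤ 0 := by
      by_contra h4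
      exact absurd h1 (not_le.2 (mul_pos h2 (not_le.1 h4)))
    have h4 : 0 < s ^ 2 := by positivity
    have h5 : u x ^ 2 ≤ 0 := by nlinarith [sq_nonneg (u x), sq_nonneg (x * q x)]
    exact pow_eq_zero_iff (two_ne_zero) |>.1 (le_antisymm h5 (sq_nonneg _))
  have h1 : EqOn u 0 (closure (Ioo 0 r)) := EqOn.closure (fun x hx => hu0 x hx) cu continuous_zero
  rw [closure_Ioo h0.ne] at h1
  have := h1 (left_mem_Icc.2 h0.le)
  rw [H.init] at this
  exact one_ne_zero this

/-- The Prüfer angle at `R`: it tends to `-∞` with `s`, and `u(R) = 0` when its cosine vanishes. -/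
lemma prufer (H : RegularSolution N R s p V u q) (hR : 0 < R) :
    (∫ r in (0 : ℝ)..R, pruferRate N s (V r) (u r) (q r) r) ≤
        Real.pi / 2 + N / 2 - s * (R / 2) ∧
      (Real.cos (∫ r in (0 : ℝ)..R, pruferRate N s (V r) (u r) (q r) r) = 0 → u R = 0) := by
  have hs := H.one_le
  have cu := H.cont_u
  have cq := H.cont_q
  have cV := H.cont_V
  obtain ⟨g, hg⟩ : ∃ g : ℝ → ℝ, g = fun r => pruferRate N s (V r) (u r) (q r) r := ⟨_, rfl⟩
  have hgon : ContinuousOn g (Icc 0 R) := by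
    rw [hg]
    unfold pruferRate
    refine ContinuousOn.sub continuousOn_const (ContinuousOn.div (by fun_prop) (by fun_prop)
      fun r hr => (H.pos hr).ne')
  obtain ⟨G, hG⟩ : ∃ G : ℝ → ℝ, G = IccExtend hR.le ((Icc 0 R).domRestrict g) := ⟨_, rfl⟩
  have cG : Continuous G := by
    rw [hG]; exact (continuousOn_iff_continuous_domRestrict.1 hgon).Icc_extend'
  have hGg : ∀ r ∈ Icc 0 R, G r = g r := fun r hr => by
    rw [hG, IccExtend_of_mem _ _ hr]; rfl
  obtain ⟨θ, hθ⟩ : ∃ θ : ℝ → ℝ, θ = fun r => ∫ x in (0 : ℝ)..r, G x := ⟨_, rfl⟩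
  have hθ' : ∀ r, HasDerivAt θ (G r) r := fun r => by
    rw [hθ]; exact (cG.integral_hasStrictDerivAt 0 r).hasDerivAt
  have hθ0 : θ 0 = 0 := by simp [hθ]
  have cθ : Continuous θ := continuous_iff_continuousAt.2 fun r => (hθ' r).continuousAt
  have hθR : (∫ r in (0 : ℝ)..R, pruferRate N s (V r) (u r) (q r) r) = θ R := by
    simp only [hθ]
    refine intervalIntegral.integral_congr fun r hr => ?_
    rw [uIcc_of_le hR.le] at hr
    simp only [hGg r hr, hg]
  rw [hθR]
  -- B is u' cos θ - s u sin θ; its vanishing says that (su, u') is parallel to (cos θ, sin θ). The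
  -- quotient B²/ρ² is constant and starts at 0.
  set B : ℝ → ℝ := fun r => -(s * u r * Real.sin (θ r)) + -(r * q r) * Real.cos (θ r) with hB
  have cB : Continuous B := by fun_prop
  have hE : ∀ r ∈ Icc 0 R, B r ^ 2 / (s ^ 2 * u r ^ 2 + (r * q r) ^ 2) = 0 := by
    have hder : ∀ r ∈ Icc 0 R, HasDerivAt
        (fun r => B r ^ 2 / (s ^ 2 * u r ^ 2 + (r * q r) ^ 2)) 0 r := by
      intro r hr
      have d1 := H.deriv_u r hr
      have d2 := H.deriv_q r hr
      have hθr := hθ' r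
      have hp := (H.pos hr).ne'
      have dB : HasDerivAt B _ r :=
        ((d1.const_mul s).mul hθr.sin).neg.add (d2.neg.mul hθr.cos)
      refine ((dB.pow 2).div (((d1.pow 2).const_mul (s ^ 2)).add (d2.pow 2)) hp).congr_deriv ?_
      simp only [Pi.add_apply, Pi.neg_apply, Pi.pow_apply]
      rw [hGg r hr, hg]
      simp only [pruferRate, hB]
      generalize r * q r = v at hp ⊢
      field_simp
      ring
    intro r hr
    have := constant_of_has_deriv_right_zero (a := 0) (b := R)
      (fun r hr => (hder r hr).continuousAt.continuousWithinAt)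
      (fun r hr => (hder r (Ico_subset_Icc_self hr)).hasDerivWithinAt) r hr
    rw [this]
    simp [hB, hθ0]
  have hB0 : ∀ r ∈ Icc 0 R, B r = 0 := fun r hr => by
    have h1 := (div_eq_zero_iff.1 (hE r hr)).resolve_right (H.pos hr).ne'
    exact pow_eq_zero_iff two_ne_zero |>.1 h1
  have hzero : ∀ r ∈ Icc 0 R, Real.cos (θ r) = 0 → u r = 0 := by
    intro r hr hc
    have h1 := hB0 r hr
    simp only [hB, hc, mul_zero, add_zero, neg_eq_zero] at h1
    have h2 := Real.sin_sq_add_cos_sq (θ r)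
    rw [hc] at h2
    have h3 : Real.sin (θ r) ≠ 0 := fun h => by rw [h] at h2; norm_num at h2
    exact (mul_eq_zero.1 ((mul_eq_zero.1 h1).resolve_right h3)).resolve_left (by linarith)
  refine ⟨?_, hzero R (right_mem_Icc.2 hR.le)⟩
  -- Where θ = π/2 the solution vanishes and the rate is -s < 0, so θ cannot cross π/2 upwards.
  have hle : ∀ ⦃r⦄, r ∈ Icc 0 R → θ r ≤ Real.pi / 2 :=
    image_le_of_deriv_right_lt_deriv_boundary cθ.continuousOn
      (fun r _ => (hθ' r).hasDerivWithinAt) (B := fun _ => Real.pi / 2) (B' := fun _ => 0)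
      (by rw [hθ0]; positivity) (fun r => hasDerivAt_const r _) fun r hr hr2 => by
        have hr' := Ico_subset_Icc_self hr
        have h1 := hzero r hr' (by rw [hr2, Real.cos_pi_div_two])
        rw [hGg r hr', hg]
        simp only [pruferRate, h1]
        simp
        linarith
  have hmid := hle (r := R / 2) ⟨by linarith, by linarith⟩
  -- Away from the origin the friction term is at most N/(2r) ≤ N/R, and the potential only
  -- decreases the angle.
  have hrate : ∀ r ∈ Icc (R / 2) R, G r ≤ N / R - s := by
    intro r hr
    have hr0 : 0 < r := lt_of_lt_of_le (by linarith) hr.1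
    have hr' : r ∈ Icc 0 R := ⟨hr0.le, hr.2⟩
    have hp := H.pos hr'
    rw [hGg r hr', hg]
    simp only [pruferRate]
    have h1 : -(N / R) ≤ s * u r * (V r * u r - N * q r) / (s ^ 2 * u r ^ 2 + (r * q r) ^ 2) := by
      rw [le_div_iff₀ hp]
      have h2 : 0 ≤ s * (V r * u r ^ 2) :=
        mul_nonneg (by linarith) (mul_nonneg (H.V_nonneg r) (sq_nonneg _))
      have h3 : 2 * (s * u r * (r * q r)) ≤ s ^ 2 * u r ^ 2 + (r * q r) ^ 2 := by
        nlinarith [sq_nonneg (s * u r - r * q r)]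
      have h4 : s * u r * q r = (2 * (s * u r * (r * q r))) / (2 * r) := by field_simp
      have h5 : s * u r * q r ≤ (s ^ 2 * u r ^ 2 + (r * q r) ^ 2) / R := by
        rw [h4]
        exact (div_le_div_of_nonneg_right h3 (by positivity)).trans
          (div_le_div_of_nonneg_left hp.le hR (by linarith [hr.1]))
      have h6 := mul_le_mul_of_nonneg_left h5 (Nat.cast_nonneg (α := ℝ) N)
      have h7 : (N : ℝ) * ((s ^ 2 * u r ^ 2 + (r * q r) ^ 2) / R) =
        N / R * (s ^ 2 * u r ^ 2 + (r * q r) ^ 2) := by ring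
      nlinarith
    linarith
  have hdiff : θ R - θ (R / 2) ≤ (N / R - s) * (R / 2) := by
    have h1 : θ R - θ (R / 2) = ∫ r in (R / 2)..R, G r := by
      simp only [hθ]
      exact integral_interval_sub_left (cG.intervalIntegrable _ _) (cG.intervalIntegrable _ _)
    have h2 := intervalIntegral.integral_mono_on (by linarith : R / 2 ≤ R)
      (cG.intervalIntegrable (μ := MeasureTheory.volume) _ _)
      (intervalIntegrable_const (c := (N : ℝ) / R - s)) hrate
    rw [h1]
    refine h2.trans_eq ?_
    rw [intervalIntegral.integral_const, smul_eq_mul]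
    ring
  have e : (N / R - s) * (R / 2) = N / 2 - s * (R / 2) := by field_simp
  linarith

end RegularSolution

/-- There are infinitely many values of the parameter for which the regular solution vanishes
at `R`. -/
lemma exists_vanishing {N : ℕ} {R p : ℝ} (hR : 0 < R) {V : ℝ → ℝ} {u q : ℝ → ℝ → ℝ}
    (cu : Continuous (Function.uncurry u)) (cq : Continuous (Function.uncurry q))
    (H : ∀ s, 1 ≤ s → RegularSolution N R s p V (u s) (q s)) (i : ℕ) :
    ∃ s : Fin i → ℝ, Function.Injective s ∧ ∀ j, 1 ≤ s j ∧ u (s j) R = 0 := by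
  have cV := (H 1 le_rfl).cont_V
  obtain ⟨Θ, hΘ⟩ : ∃ Θ : ℝ → ℝ, Θ = fun s => ∫ r in (0 : ℝ)..R,
    pruferRate N s (V r) (u s r) (q s r) r := ⟨_, rfl⟩
  -- Clamping r to [0, R] and s to [1, ∞) keeps the denominator of the rate positive everywhere, so
  -- the integrand is globally continuous.
  set cl : ℝ → ℝ := fun r => projIcc 0 R hR.le r with hcl
  have ccl : Continuous cl := continuous_subtype_val.comp continuous_projIcc
  have hclm : ∀ r, cl r ∈ Icc 0 R := fun r => (projIcc 0 R hR.le r).2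
  have cΘ : ContinuousOn Θ (Ici 1) := by
    have h1 : Continuous fun s : ℝ => ∫ r in (0 : ℝ)..R,
        pruferRate N (max s 1) (V (cl r)) (u (max s 1) (cl r)) (q (max s 1) (cl r)) (cl r) := by
      refine intervalIntegral.continuous_parametric_intervalIntegral_of_continuous' ?_ 0 R
      have c1 : Continuous fun x : ℝ × ℝ => u (max x.1 1) (cl x.2) :=
        cu.comp (by fun_prop : Continuous fun x : ℝ × ℝ => (max x.1 1, cl x.2))
      have c2 : Continuous fun x : ℝ × ℝ => q (max x.1 1) (cl x.2) :=
        cq.comp (by fun_prop : Continuous fun x : ℝ × ℝ => (max x.1 1, cl x.2))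
      unfold pruferRate
      simp only [Function.uncurry_def]
      refine Continuous.sub (by fun_prop) (Continuous.div (by fun_prop) (by fun_prop) fun x => ?_)
      exact ((H _ (le_max_right x.1 1)).pos (hclm x.2)).ne'
    refine h1.continuousOn.congr fun s hs => ?_
    rw [hΘ]
    refine intervalIntegral.integral_congr fun r hr => ?_
    rw [uIcc_of_le hR.le] at hr
    have : cl r = r := by simp only [hcl, projIcc_of_mem hR.le hr]
    simp only [this, max_eq_left (show 1 ≤ s from hs)]
  have hlim : ∀ y, ∃ S, 1 ≤ S ∧ Θ S ≤ y := fun y => by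
    obtain ⟨S, hS⟩ := exists_gt (max 1 ((Real.pi / 2 + N / 2 - y) / (R / 2)))
    have hS1 := (le_max_left _ _).trans hS.le
    have hS2 := (le_max_right _ _).trans hS.le
    rw [div_le_iff₀ (by linarith)] at hS2
    refine ⟨S, hS1, ?_⟩
    have := ((H S hS1).prufer hR).1
    rw [hΘ]
    dsimp only
    linarith
  have hval : ∀ y, y ≤ Θ 1 → ∃ s, 1 ≤ s ∧ Θ s = y := fun y hy => by
    obtain ⟨S, hS1, hS⟩ := hlim y
    obtain ⟨s, hs, hsy⟩ := intermediate_value_Icc' hS1 (cΘ.mono Icc_subset_Ici_self) ⟨hS, hy⟩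
    exact ⟨s, hs.1, hsy⟩
  -- The shift k puts all targets π/2 - (k+1+j)π, zeros of the cosine, below Θ(1).
  obtain ⟨k, hk⟩ := exists_nat_gt (-Θ 1)
  have hy : ∀ j : Fin i, Real.pi / 2 - ((k + 1 + j : ℕ) : ℝ) * Real.pi ≤ Θ 1 := fun j => by
    have h3 := Real.pi_gt_three
    have h4 : (0 : ℝ) ≤ j := Nat.cast_nonneg _
    have h5 : (0 : ℝ) ≤ k := Nat.cast_nonneg _
    push_cast
    nlinarith
  choose s hs1 hs using fun j => hval _ (hy j)
  refine ⟨s, fun j j' hjj => ?_, fun j => ⟨hs1 j, ?_⟩⟩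
  · have h1 := hs j
    rw [hjj, hs j'] at h1
    have h2 : ((k + 1 + j' : ℕ) : ℝ) = ((k + 1 + j : ℕ) : ℝ) :=
      mul_right_cancel₀ Real.pi_ne_zero (by linarith)
    have h3 : k + 1 + (j' : ℕ) = k + 1 + (j : ℕ) := Nat.cast_injective h2
    exact Fin.ext (by omega)
  · refine ((H _ (hs1 j)).prufer hR).2 ?_
    have h1 := hs j
    rw [hΘ] at h1
    dsimp only at h1
    rw [h1, Real.cos_sub_nat_mul_pi, Real.cos_pi_div_two, mul_zero]

/-! ### From vanishing solutions to eigenvalues -/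

/-- A regular solution vanishing at `R` gives an eigenfunction. -/
lemma eigenspace_ne_bot {n : ℕ} (hn : 5 ≤ n) {R L μ : ℝ} (hR : 0 < R) (hL : R ^ 2 < L)
    {U m m' : ℝ → ℝ} (cU : Continuous U) (hU0 : U 0 = 1) (cm : Continuous m')
    (hU : ∀ t ∈ Ioo (-1) L, HasDerivAt U (-m t / 2) t ∧ HasDerivAt m (m' t) t ∧
      2 * t * m' t + n * m t = (potentialSq n t + μ) * U t) (hUR : U (R ^ 2) = 0) :
    eigenspace n R μ ≠ ⊥ := by
  have hmem : ∀ r ∈ Icc 0 R, r ^ 2 ∈ Ioo (-1) L := fun r hr =>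
    ⟨by nlinarith [sq_nonneg r], (pow_le_pow_left₀ hr.1 hr.2 2).trans_lt hL⟩
  have hC1 : ContDiffOn ℝ 1 m (Ioo (-1) L) := by
    rw [show (1 : WithTop ℕ∞) = 0 + 1 by norm_num, contDiffOn_succ_iff_deriv_of_isOpen isOpen_Ioo]
    refine ⟨fun t ht => (hU t ht).2.1.differentiableAt.differentiableWithinAt, by simp, ?_⟩
    rw [contDiffOn_zero]
    exact cm.continuousOn.congr fun t ht => (hU t ht).2.1.deriv
  have hC2 : ContDiffOn ℝ 2 U (Ioo (-1) L) := by
    rw [show (2 : WithTop ℕ∞) = 1 + 1 by norm_num, contDiffOn_succ_iff_deriv_of_isOpen isOpen_Ioo]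
    refine ⟨fun t ht => (hU t ht).1.differentiableAt.differentiableWithinAt, by simp, ?_⟩
    exact (hC1.neg.div_const 2).congr fun t ht => (hU t ht).1.deriv
  -- Truncating the norm at R is extension by zero, because U(R²) = 0.
  refine (Submodule.ne_bot_iff _).2 ⟨fun x => U (min ‖x‖ R ^ 2),
    ⟨by fun_prop, ?_, fun x y h => by simp only [h], fun x hx => by
      simp only [min_eq_right hx, hUR], fun x hx => ?_⟩, fun h => ?_⟩
  · have h1 : ContDiffOn ℝ 2 (fun x : EuclideanSpace ℝ (Fin n) => U (‖x‖ ^ 2))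
        (Metric.ball 0 R) := by
      refine hC2.comp (contDiff_norm_sq ℝ).contDiffOn fun x hx => ?_
      rw [mem_ball_zero_iff] at hx
      exact hmem _ ⟨norm_nonneg x, hx.le⟩
    refine h1.congr fun x hx => ?_
    rw [mem_ball_zero_iff] at hx
    rw [min_eq_left hx.le]
  · have hx' := mem_ball_zero_iff.1 hx
    have h1 : (fun x : EuclideanSpace ℝ (Fin n) => U (min ‖x‖ R ^ 2)) =ᶠ[𝓝 x]
        fun x => U (‖x‖ ^ 2) := by
      filter_upwards [Metric.isOpen_ball.mem_nhds hx] with y hy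
      rw [min_eq_left (mem_ball_zero_iff.1 hy).le]
    have hm := hmem _ ⟨norm_nonneg x, hx'.le⟩
    rw [(InnerProductSpace.laplacian_congr_nhds h1).eq_of_nhds,
      laplacian_comp_normSq (F1 := fun t => -m t / 2) (F2 := -m' (‖x‖ ^ 2) / 2) x
        (by filter_upwards [isOpen_Ioo.mem_nhds hm] with t ht using (hU t ht).1)
        ((hU _ hm).2.1.neg.div_const 2), potential_eq_radialPotential hn, ← potentialSq_sq]
    simp only [min_eq_left hx'.le]
    have := (hU _ hm).2.2
    linarith
  · have := congrFun h 0
    simp [hU0, min_eq_left hR.le] at this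

/-- There are arbitrarily many eigenvalues. -/
lemma exists_eigenvalues {n : ℕ} (hn : 5 ≤ n) {R : ℝ} (hR : 0 < R) (i : ℕ) :
    ∃ ν : Fin i → ℝ, Function.Injective ν ∧ ∀ j, eigenspace n R (ν j) ≠ ⊥ := by
  -- L = R² + 1 makes t = R² an interior point of the solution interval.
  obtain ⟨U, m, cU, cm, hU⟩ := exists_regular_solution hn (L := R ^ 2 + 1)
    (by nlinarith [sq_nonneg R])
  choose hU0 m' cm' hode using hU
  have cu : Continuous (Function.uncurry fun s r : ℝ => U (s ^ 2) (r ^ 2)) :=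
    cU.comp (by fun_prop : Continuous fun x : ℝ × ℝ => (x.1 ^ 2, x.2 ^ 2))
  have cq : Continuous (Function.uncurry fun s r : ℝ => m (s ^ 2) (r ^ 2)) :=
    cm.comp (by fun_prop : Continuous fun x : ℝ × ℝ => (x.1 ^ 2, x.2 ^ 2))
  have hmem : ∀ r ∈ Icc 0 R, r ^ 2 ∈ Ioo (-1) (R ^ 2 + 1) := fun r hr =>
    ⟨by nlinarith [sq_nonneg r], (pow_le_pow_left₀ hr.1 hr.2 2).trans_lt (lt_add_one _)⟩
  obtain ⟨s, hinj, hs⟩ := exists_vanishing (N := n - 1) (p := critExp n) (V := radialPotential n)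
    hR cu cq (fun s h1 => by
      refine ⟨h1, continuous_radialPotential hn, cu.comp (Continuous.prodMk_right s),
        cq.comp (Continuous.prodMk_right s), fun r => (radialPotential_pos hn r).le,
        radialPotential_le hn, ?_, fun r hr => ?_, fun r hr => ?_⟩
      · simp [hU0]
      · have d := HasDerivAt.comp (h := fun r : ℝ => r ^ 2) r (hode (s ^ 2) _ (hmem r hr)).1
          (hasDerivAt_pow 2 r)
        refine d.congr_deriv ?_
        push_cast
        ring
      · have d := (hasDerivAt_id r).mul (HasDerivAt.comp (h := fun r : ℝ => r ^ 2) r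
          (hode (s ^ 2) _ (hmem r hr)).2.1 (hasDerivAt_pow 2 r))
        refine d.congr_deriv ?_
        have h2 := (hode (s ^ 2) _ (hmem r hr)).2.2
        rw [potentialSq_sq] at h2
        rw [← h2, Nat.cast_sub (by omega)]
        simp only [id, Function.comp]
        push_cast
        ring) i
  refine ⟨fun j => s j ^ 2, fun j j' h => hinj ?_, fun j => ?_⟩
  · exact (pow_left_inj₀ (by linarith [(hs j).1]) (by linarith [(hs j').1]) two_ne_zero).1 h
  · exact eigenspace_ne_bot hn hR (lt_add_one (R ^ 2)) (cU.comp (Continuous.prodMk_right _))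
      (hU0 _) (cm' _) (hode _) (hs j).2

end RadialDirichlet

end

theorem lemma3p3 (n : ℕ) (hn : 5 ≤ n) :
    ∃ c : ℝ, 0 < c ∧ ∀ R : ℝ, 1 < R →
      (∃ μ₃ : ℝ, RadialDirichlet.IsNthEigenvalue n R 3 μ₃) ∧
      ∀ μ₃ : ℝ, RadialDirichlet.IsNthEigenvalue n R 3 μ₃ →
        μ₃ > c * R ^ (-(n : ℝ) / 2) := by
  obtain ⟨c, hc, hrank⟩ := RadialDirichlet.exists_rank_spectralSpace_le_two hn
  refine ⟨c, hc, fun R hR => ⟨?_, fun μ₃ hμ => ?_⟩⟩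
  · obtain ⟨ν, hν, hE⟩ := RadialDirichlet.exists_eigenvalues hn (by linarith : 0 < R) 3
    exact RadialDirichlet.exists_isNthEigenvalue hn (by linarith) (by norm_num) ν hν hE
  · by_contra hcon
    have h1 := (hμ.2.trans (Submodule.rank_mono
      (RadialDirichlet.spectralSpace_mono n R (not_lt.1 hcon)))).trans (hrank R hR)
    exact absurd (Nat.cast_le.1 h1) (by norm_num)
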